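/- Let $\Omega$ be a compact metric space, $T:\Omega\to\Omega$ a homeomorphism such that $(\Omega,T)$ is minimal (every orbit $\{T^n\omega:n\in\mathbb Z\}$ is dense), and $f:\Omega\to\mathbb D=\{z\in\mathbb C:|z|<1\}$ continuous. For $\omega\in\Omega$ put $\alpha_n=f(T^n\omega)$ and $\rho_n=(1-|\alpha_n|^2)^{1/2}$ for $n\in\mathbb Z$, and let $\mathcal E_\omega$ be the extended CMV matrix with these Verblunsky coefficients, i.e. the bounded operator on $\ell^2(\mathbb Z)$ whose matrix entries $\mathcal E_{i,j}=\langle\delta_i,\mathcal E_\omega\delta_j\rangle$ are, for $i$ even, $$\mathcal E_{i,i-1}=\overline{\alpha_i}\rho_{i-1},\quad \mathcal E_{i,i}=-\overline{\alpha_i}\alpha_{i-1},\quad \mathcal E_{i,i+1}=\overline{\alpha_{i+1}}\rho_i,\quad \mathcal E_{i,i+2}=\rho_{i+1}\rho_i,$$ for $i$ odd, $$\mathcal E_{i,i-2}=\rho_{i-1}\rho_{i-2},\quad \mathcal E_{i,i-1}=-\rho_{i-1}\alpha_{i-2},\quad \mathcal E_{i,i}=-\overline{\alpha_i}\alpha_{i-1},\quad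 \mathcal E_{i,i+1}=-\rho_i\alpha_{i-1},$$ and $0$ otherwise. For $z\in\partial\mathbb D$ let $A_z:\Omega\to\{M\in \mathrm{GL}(2,\mathbb C):|\det M|=1\}$ be the Szegő cocycle $$A_z(\omega)=\frac1{\sqrt{1-|f(\omega)|^2}}\begin{pmatrix} z & -\overline{f(\omega)}\\ -f(\omega)z & 1\end{pmatrix},$$ and let $A_z^n(\omega)$, $n\in\mathbb Z$, be defined by $(T,A_z)^n=(T^n,A_z^n)$ for the skew product $(T,A_z)(\omega,v)=(T\omega,A_z(\omega)v)$. The cocycle $(T,A_z)$ is called uniformly hyperbolic if any one of the following conditions holds (they are equivalent): (a) there are $C>0$, $\lambda>1$ with $\|A_z^n(\omega)\|\ge C\lambda^{|n|}$ for all $n\in\mathbb Z$, $\omega\in\Omega$; (b) there are $c>0$, $L>1$ and continuous maps $\Lambda^s,\Lambda^u:\Omega\to\mathbb{CP}^1$ (with the angle metric on $\mathbb{CP}^1$) such that $A_z(\omega)\Lambda^{s}(\omega)=\Lambda^{s}(T\omega)$ and $A_z(\omega)\Lambda^{u}(\omega)=\Lambda^{u}(T\omega)$ for all $\omega\in\Omega$,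 and $\|A_z^n(\omega)v_s\|\le cL^{-n}\|v_s\|$, $\|A_z^{-n}(\omega)v_u\|\le cL^{-n}\|v_u\|$ for all $n\ge1$, $\omega\in\Omega$, $v_s\in\Lambda^s(\omega)$, $v_u\in\Lambda^u(\omega)$; (c) there are no $\omega\in\Omega$ and $v\in\mathbb C^2$ with $\|v\|=1$ and $\|A_z^n(\omega)v\|\le1$ for all $n\in\mathbb Z$. Then there is a compact set $\Sigma\subseteq\partial\mathbb D$ such that $\sigma(\mathcal E_\omega)=\Sigma$ for every $\omega\in\Omega$. Moreover $\Sigma=\partial\mathbb D\setminus U$, where $U=\{z\in\partial\mathbb D:(T,A_z)\text{ is uniformly hyperbolic}\}$, for each of the readings (a), (b), (c) of uniform hyperbolicity. -/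

import Mathlib

open scoped Complex.UnitDisc ComplexConjugate

noncomputable section

/-! ### Cocycles over a homeomorphism -/

/-- The plane `ℂ²` with its standard Hermitian inner product. -/
abbrev C2 : Type := EuclideanSpace ℂ (Fin 2)

/-- The group `G` of the matrices in `GL(2, ℂ)` whose determinant has absolute value one. -/
def unimodularGL2 : Subgroup (GL (Fin 2) ℂ) where
  carrier := {M | ‖(M : Matrix (Fin 2) (Fin 2) ℂ).det‖ = 1}
  one_mem' := by simp
  mul_mem' := by
    intro a b ha hb
    simp only [Set.mem_ofPred_eq] at ha hb ⊢
    simp [Matrix.det_mul, ha, hb]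
  inv_mem' := by
    intro a ha
    simp only [Set.mem_ofPred_eq] at ha ⊢
    simp [ha]

/-- A matrix in `G` as a bounded operator on `ℂ²`; its norm is the operator norm that comes from
the Euclidean norm. -/
def matOp (M : unimodularGL2) : C2 →L[ℂ] C2 :=
  Matrix.toEuclideanCLM (n := Fin 2) (𝕜 := ℂ) ((M : GL (Fin 2) ℂ) : Matrix (Fin 2) (Fin 2) ℂ)

section Cocycle

variable {Ω : Type*} [MetricSpace Ω]

/-- `(Ω, T)` is minimal: every orbit `{T ^ n ω : n ∈ ℤ}` is dense in `Ω`. -/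
def IsMinimalHomeo (T : Ω ≃ₜ Ω) : Prop :=
  ∀ ω : Ω, Dense (Set.range fun n : ℤ => (T ^ n) ω)

/-- The iterates `A ^ n` of the cocycle `(T, A)` for `n ≥ 0`:
`A ^ n (ω) = A (T ^ (n - 1) ω) ⋯ A (ω)`. -/
def cocycleForward (T : Ω ≃ₜ Ω) (A : Ω → unimodularGL2) : ℕ → Ω → unimodularGL2
  | 0, _ => 1
  | n + 1, ω => A ((T ^ (n : ℤ)) ω) * cocycleForward T A n ω

/-- The iterates `A ^ (-n)` of the cocycle `(T, A)` for `n ≥ 0`: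
`A ^ (-n) (ω) = A (T ^ (-n) ω)⁻¹ ⋯ A (T ^ (-1) ω)⁻¹`. -/
def cocycleBackward (T : Ω ≃ₜ Ω) (A : Ω → unimodularGL2) : ℕ → Ω → unimodularGL2
  | 0, _ => 1
  | n + 1, ω => (A ((T ^ (-((n : ℤ) + 1))) ω))⁻¹ * cocycleBackward T A n ω

/-- The iterates `A ^ n`, `n ∈ ℤ`, of the cocycle `(T, A)`. -/
def cocycleIter (T : Ω ≃ₜ Ω) (A : Ω → unimodularGL2) : ℤ → Ω → unimodularGL2
  | Int.ofNat n => cocycleForward T A n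
  | Int.negSucc n => cocycleBackward T A (n + 1)

/-- Uniform exponential growth of `(T, A)`. -/
def UniformExpGrowth (T : Ω ≃ₜ Ω) (A : Ω → unimodularGL2) : Prop :=
  ∃ C l : ℝ, 0 < C ∧ 1 < l ∧
    ∀ (n : ℤ) (ω : Ω), C * l ^ n.natAbs ≤ ‖matOp (cocycleIter T A n ω)‖

/-- The angle metric on the complex projective line:
`∠(V, W) = arccos |⟨v, w⟩|` for unit vectors `v ∈ V`, `w ∈ W`. -/
def lineAngle (V W : Projectivization ℂ C2) : ℝ :=
  Real.arccos (‖inner ℂ V.rep W.rep‖ / (‖V.rep‖ * ‖W.rep‖))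

/-- The angle does not depend on the vectors that represent the two lines. -/
lemma lineAngle_mk {v w : C2} (hv : v ≠ 0) (hw : w ≠ 0) :
    lineAngle (Projectivization.mk ℂ v hv) (Projectivization.mk ℂ w hw) =
      Real.arccos (‖inner ℂ v w‖ / (‖v‖ * ‖w‖)) := by
  obtain ⟨a, ha⟩ := Projectivization.exists_smul_eq_mk_rep ℂ v hv
  obtain ⟨b, hb⟩ := Projectivization.exists_smul_eq_mk_rep ℂ w hw
  have ha' : ‖(a : ℂ)‖ ≠ 0 := norm_ne_zero_iff.2 a.ne_zero
  have hb' : ‖(b : ℂ)‖ ≠ 0 := norm_ne_zero_iff.2 b.ne_zero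
  have hv' : ‖v‖ ≠ 0 := norm_ne_zero_iff.2 hv
  have hw' : ‖w‖ ≠ 0 := norm_ne_zero_iff.2 hw
  rw [lineAngle, ← ha, ← hb, Units.smul_def, Units.smul_def, inner_smul_left, inner_smul_right,
    norm_smul, norm_smul, norm_mul, norm_mul, RCLike.norm_conj]
  congr 1
  field_simp

/-- Continuity of a map into the complex projective line with its angle metric. -/
def LineContinuous (Λ : Ω → Projectivization ℂ C2) : Prop :=
  ∀ ω : Ω, ∀ ε > 0, ∃ δ > 0, ∀ ω' : Ω, dist ω' ω < δ → lineAngle (Λ ω') (Λ ω) < ε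

/-- `(T, A)` admits an invariant exponential splitting. -/
def HasExpSplitting (T : Ω ≃ₜ Ω) (A : Ω → unimodularGL2) : Prop :=
  ∃ (c L : ℝ) (Λs Λu : Ω → Projectivization ℂ C2),
    0 < c ∧ 1 < L ∧ LineContinuous Λs ∧ LineContinuous Λu ∧
    (∀ ω : Ω,
      (Λs ω).submodule.map (matOp (A ω)).toLinearMap = (Λs (T ω)).submodule ∧
      (Λu ω).submodule.map (matOp (A ω)).toLinearMap = (Λu (T ω)).submodule) ∧
    ∀ (n : ℕ) (ω : Ω), 0 < n →
      (∀ v ∈ (Λs ω).submodule, ‖matOp (cocycleIter T A (n : ℤ) ω) v‖ ≤ c * (L ^ n)⁻¹ * ‖v‖) ∧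
      (∀ v ∈ (Λu ω).submodule, ‖matOp (cocycleIter T A (-(n : ℤ)) ω) v‖ ≤ c * (L ^ n)⁻¹ * ‖v‖)

/-- `(T, A)` enjoys a Sacker-Sell solution: an orbit of a unit vector that stays in the unit
ball for all positive and negative times. -/
def HasSackerSell (T : Ω ≃ₜ Ω) (A : Ω → unimodularGL2) : Prop :=
  ∃ (ω : Ω) (v : C2), ‖v‖ = 1 ∧ ∀ n : ℤ, ‖matOp (cocycleIter T A n ω) v‖ ≤ 1

end Cocycle

/-! ### The Szegő cocycle -/

/-- `ρ = (1 - |α|²) ^ (1/2)`. -/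
def cmvRho (α : 𝔻) : ℝ := Real.sqrt (1 - ‖(α : ℂ)‖ ^ 2)

lemma cmvRho_sq (α : 𝔻) : cmvRho α ^ 2 = 1 - ‖(α : ℂ)‖ ^ 2 := by
  have h := α.norm_lt_one
  have h0 := norm_nonneg (α : ℂ)
  rw [cmvRho, Real.sq_sqrt (by nlinarith)]

lemma cmvRho_pos (α : 𝔻) : 0 < cmvRho α := by
  have h := α.norm_lt_one
  have h0 := norm_nonneg (α : ℂ)
  exact Real.sqrt_pos.2 (by nlinarith)

lemma norm_cmvRho_le (α : 𝔻) : ‖(cmvRho α : ℂ)‖ ≤ 1 := by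
  rw [Complex.norm_real, Real.norm_of_nonneg (cmvRho_pos α).le]
  nlinarith [cmvRho_sq α, sq_nonneg ‖(α : ℂ)‖, cmvRho_pos α]

/-- The Szegő matrix `S(α, z)`. -/
def szegoMatrix (α : 𝔻) (z : Circle) : Matrix (Fin 2) (Fin 2) ℂ :=
  (1 / (cmvRho α : ℂ)) • !![(z : ℂ), -conj (α : ℂ); -(α : ℂ) * (z : ℂ), 1]

lemma szegoMatrix_det (α : 𝔻) (z : Circle) : (szegoMatrix α z).det = (z : ℂ) := by
  have hρ : (cmvRho α : ℂ) ≠ 0 := by exact_mod_cast (cmvRho_pos α).ne'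
  have h2 : (cmvRho α : ℂ) ^ 2 = 1 - conj (α : ℂ) * (α : ℂ) := by
    rw [← Complex.normSq_eq_conj_mul_self, Complex.normSq_eq_norm_sq]
    exact_mod_cast cmvRho_sq α
  simp only [szegoMatrix, Matrix.det_smul, Fintype.card_fin, Matrix.det_fin_two_of]
  field_simp
  rw [h2]

/-- The Szegő matrix as an element of `G`. -/
def szegoElt (α : 𝔻) (z : Circle) : unimodularGL2 :=
  ⟨Matrix.GeneralLinearGroup.mkOfDetNeZero (szegoMatrix α z)
      (by rw [szegoMatrix_det]; exact z.coe_ne_zero),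
    show ‖(szegoMatrix α z).det‖ = 1 by rw [szegoMatrix_det]; exact z.norm_coe⟩

/-- The Szegő cocycle `A_z(ω) = S(f(ω), z)`. -/
def szegoCocycle {Ω : Type*} (f : Ω → 𝔻) (z : Circle) : Ω → unimodularGL2 :=
  fun ω => szegoElt (f ω) z

/-! ### Extended CMV matrices -/

/-- The entries of the extended CMV matrix with Verblunsky coefficients `α`. -/
def cmvEntry (α : ℤ → 𝔻) : Matrix ℤ ℤ ℂ := fun i j =>
  if Even i then
    if j = i - 1 then conj (α i : ℂ) * (cmvRho (α (i - 1)) : ℂ)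
    else if j = i then -conj (α i : ℂ) * (α (i - 1) : ℂ)
    else if j = i + 1 then conj (α (i + 1) : ℂ) * (cmvRho (α i) : ℂ)
    else if j = i + 2 then (cmvRho (α (i + 1)) : ℂ) * (cmvRho (α i) : ℂ)
    else 0
  else
    if j = i - 2 then (cmvRho (α (i - 1)) : ℂ) * (cmvRho (α (i - 2)) : ℂ)
    else if j = i - 1 then -(cmvRho (α (i - 1)) : ℂ) * (α (i - 2) : ℂ)
    else if j = i then -conj (α i : ℂ) * (α (i - 1) : ℂ)
    else if j = i + 1 then -(cmvRho (α i) : ℂ) * (α (i - 1) : ℂ)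
    else 0

lemma norm_cmvEntry_le (α : ℤ → 𝔻) (i j : ℤ) : ‖cmvEntry α i j‖ ≤ 1 := by
  have hα : ∀ k, ‖(α k : ℂ)‖ ≤ 1 := fun k => (α k).norm_lt_one.le
  have hρ : ∀ k, ‖(cmvRho (α k) : ℂ)‖ ≤ 1 := fun k => norm_cmvRho_le (α k)
  unfold cmvEntry
  split_ifs <;> simp only [norm_mul, norm_neg, RCLike.norm_conj, norm_zero, zero_le_one] <;>
    exact mul_le_one₀ (by first | exact hα _ | exact hρ _) (norm_nonneg _)
      (by first | exact hα _ | exact hρ _)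

/-- The Hilbert space `ℓ²(ℤ)`. -/
abbrev ellTwo : Type := lp (fun _ : ℤ => ℂ) 2

lemma cmvDiagonal_sum_le (α : ℤ → 𝔻) (k : ℤ) (u : ellTwo) (s : Finset ℤ) :
    ∑ n ∈ s, ‖cmvEntry α n (n + k) * u (n + k)‖ ^ (2 : ENNReal).toReal ≤
      ‖u‖ ^ (2 : ENNReal).toReal := by
  calc ∑ n ∈ s, ‖cmvEntry α n (n + k) * u (n + k)‖ ^ (2 : ENNReal).toReal
      ≤ ∑ n ∈ s, ‖u (n + k)‖ ^ (2 : ENNReal).toReal := by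
        refine Finset.sum_le_sum fun n _ => Real.rpow_le_rpow (norm_nonneg _) ?_ (by simp)
        rw [norm_mul]
        exact mul_le_of_le_one_left (norm_nonneg _) (norm_cmvEntry_le α _ _)
    _ = ∑ m ∈ s.map (Equiv.addRight k).toEmbedding, ‖u m‖ ^ (2 : ENNReal).toReal := by
        simp [Finset.sum_map]
    _ ≤ ‖u‖ ^ (2 : ENNReal).toReal := lp.sum_rpow_le_norm_rpow (by simp) u _

/-- The `k`-th diagonal of the extended CMV matrix, as a bounded operator on `ℓ²(ℤ)`. -/
def cmvDiagonal (α : ℤ → 𝔻) (k : ℤ) : ellTwo →L[ℂ] ellTwo :=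
  LinearMap.mkContinuous
    { toFun := fun u => ⟨fun n => cmvEntry α n (n + k) * u (n + k),
        memℓp_gen' (cmvDiagonal_sum_le α k u)⟩
      map_add' := fun u v => by
        ext n
        exact mul_add _ _ _
      map_smul' := fun c u => by
        ext n
        exact mul_left_comm _ _ _ }
    1
    (fun u => by
      rw [one_mul]
      exact lp.norm_le_of_forall_sum_le (by simp) (norm_nonneg u) (cmvDiagonal_sum_le α k u))

/-- The extended CMV matrix with Verblunsky coefficients `α`, as a bounded operator on `ℓ²(ℤ)`:
the sum of its five diagonals. -/
def extendedCMV (α : ℤ → 𝔻) : ellTwo →L[ℂ] ellTwo :=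
  ∑ k ∈ Finset.Icc (-2 : ℤ) 2, cmvDiagonal α k

lemma extendedCMV_apply (α : ℤ → 𝔻) (u : ellTwo) (n : ℤ) :
    extendedCMV α u n = ∑ k ∈ Finset.Icc (-2 : ℤ) 2, cmvEntry α n (n + k) * u (n + k) := by
  rw [extendedCMV, sum_apply, lp.coeFn_sum, Finset.sum_apply]
  rfl

/-- The matrix of `extendedCMV α` in the standard basis of `ℓ²(ℤ)` is `cmvEntry α`. -/
lemma extendedCMV_single (α : ℤ → 𝔻) (i j : ℤ) :
    extendedCMV α (lp.single 2 j (1 : ℂ)) i = cmvEntry α i j := by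
  rw [extendedCMV_apply]
  by_cases h : j - i ∈ Finset.Icc (-2 : ℤ) 2
  · rw [Finset.sum_eq_single (j - i)]
    · simp
    · intro k _ hk
      have : i + k ≠ j := by omega
      simp [this]
    · exact fun h' => absurd h h'
  · rw [Finset.sum_eq_zero]
    · simp only [Finset.mem_Icc, not_and_or, not_le] at h
      unfold cmvEntry
      split_ifs <;> first | rfl | omega
    · intro k hk
      have : i + k ≠ j := by
        rintro rfl
        exact h (by simpa using hk)
      simp [this]

end

open scoped Complex.UnitDisc ComplexConjugate

noncomputable section

/-! ### Basic facts on the plane and on cocycle iterates -/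

/-! For each `z` on the circle everything is compared with one condition, the existence of a bounded
orbit of the cocycle (`HasSackerSell`). It does not mention a base point, which is why the spectrum
does not depend on `ω`.

Equivalence of (a), (b), (c). If no orbit is bounded, compactness makes every vector double its norm
within a fixed time (`exists_doublesWithin`). An orbit bounded on a half-line must then decay
exponentially there, and area preservation shows that such vectors form exactly a line over each
point; these lines are the splitting (`exists_line_decay`). A contracted direction forces the norm
of the iterate to grow, because `|det| = 1`. Conversely, along a bounded orbit the cocycle is
triangular in a moving frame, so on suitable long windows its norm grows at most linearly
(`norm_iter_le_of_level`), which contradicts exponential growth.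

No bounded orbit implies resolvent set. The CMV operator is a product of two block-diagonal
unitaries. With `y` the image of `u` under the right factor, the pairs `(u, y)`, rearranged by
parity, satisfy the Szegő recursion up to a defect controlled by `(E - z) u`. Doubling bounds any
bounded sequence in `ℓ²` by its defects (`exists_sum_norm_sq_le`), so `E - z` is bounded below; for
a unitary `E` this gives invertibility.

A bounded orbit implies spectrum. By minimality the orbit of any `ω` comes so close to the base
point of the bounded orbit that the solution over `ω` stays bounded on an arbitrarily long window. A
tent cutoff of width `R` turns it into an approximate eigenvector whose squared error is of order `1
/ R` (`lower_bound_of_long_solution`). -/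

lemma C2.norm_sq (x : C2) : ‖x‖ ^ 2 = ‖x 0‖ ^ 2 + ‖x 1‖ ^ 2 := by
  rw [EuclideanSpace.norm_sq_eq, Fin.sum_univ_two]

lemma matOp_apply_zero (M : unimodularGL2) (x : C2) :
    matOp M x 0 = (M : GL (Fin 2) ℂ) 0 0 * x 0 + (M : GL (Fin 2) ℂ) 0 1 * x 1 := by
  simp [matOp, Matrix.mulVec, dotProduct, Fin.sum_univ_two]

lemma matOp_apply_one (M : unimodularGL2) (x : C2) :
    matOp M x 1 = (M : GL (Fin 2) ℂ) 1 0 * x 0 + (M : GL (Fin 2) ℂ) 1 1 * x 1 := by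
  simp [matOp, Matrix.mulVec, dotProduct, Fin.sum_univ_two]

lemma matOp_one_apply (x : C2) : matOp 1 x = x := by
  simp [matOp]

lemma matOp_mul_apply (M N : unimodularGL2) (x : C2) :
    matOp (M * N) x = matOp M (matOp N x) := by
  simp [matOp, map_mul]

lemma matOp_inv_apply_self (M : unimodularGL2) (x : C2) : matOp M⁻¹ (matOp M x) = x := by
  rw [← matOp_mul_apply, inv_mul_cancel, matOp_one_apply]

lemma matOp_apply_inv_self (M : unimodularGL2) (x : C2) : matOp M (matOp M⁻¹ x) = x := by
  rw [← matOp_mul_apply, mul_inv_cancel, matOp_one_apply]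

lemma matOp_ne_zero (M : unimodularGL2) {x : C2} (hx : x ≠ 0) : matOp M x ≠ 0 := fun h =>
  hx (by rw [← matOp_inv_apply_self M x, h, map_zero])

lemma continuous_matOp : Continuous matOp := by
  let l : Matrix (Fin 2) (Fin 2) ℂ →ₗ[ℂ] C2 →L[ℂ] C2 :=
    { toFun := Matrix.toEuclideanCLM (n := Fin 2) (𝕜 := ℂ)
      map_add' := map_add _
      map_smul' := map_smul _ }
  have h : Continuous l := LinearMap.continuous_of_finiteDimensional l
  exact h.comp (Units.continuous_val.comp continuous_subtype_val)

/-- The determinant of the matrix with columns `x` and `y`. -/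
def wedge (x y : C2) : ℂ := x 0 * y 1 - x 1 * y 0

/-- A vector orthogonal to `x`, of the same norm. -/
def perp (x : C2) : C2 := !₂[-conj (x 1), conj (x 0)]

@[simp] lemma perp_zero (x : C2) : perp x 0 = -conj (x 1) := rfl
@[simp] lemma perp_one (x : C2) : perp x 1 = conj (x 0) := rfl

lemma norm_perp (x : C2) : ‖perp x‖ = ‖x‖ := by
  rw [← sq_eq_sq₀ (norm_nonneg _) (norm_nonneg _), C2.norm_sq, C2.norm_sq]
  simp [add_comm]

lemma inner_C2 (x y : C2) : inner ℂ x y = conj (x 0) * y 0 + conj (x 1) * y 1 := by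
  simp [PiLp.inner_apply, Fin.sum_univ_two, mul_comm]

lemma norm_wedge_le (x y : C2) : ‖wedge x y‖ ≤ ‖x‖ * ‖y‖ := by
  have h : wedge x y = inner ℂ (perp x) y := by
    rw [inner_C2]; simp [wedge]; ring
  rw [h, ← norm_perp x]
  exact norm_inner_le_norm _ _

lemma wedge_perp (x : C2) : wedge x (perp x) = (‖x‖ : ℂ) ^ 2 := by
  have h : ((‖x‖ ^ 2 : ℝ) : ℂ) = x 0 * conj (x 0) + x 1 * conj (x 1) := by
    rw [C2.norm_sq, Complex.mul_conj, Complex.mul_conj, Complex.normSq_eq_norm_sq,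
      Complex.normSq_eq_norm_sq]
    push_cast; rfl
  push_cast at h
  rw [h]; simp [wedge]

/-- Expansion in the orthogonal basis `v`, `perp v`, multiplied out to avoid dividing by the norm.
-/
lemma norm_sq_smul_eq (v x : C2) :
    ((‖v‖ : ℂ) ^ 2) • x = (inner ℂ v x : ℂ) • v + wedge v x • perp v := by
  rw [← wedge_perp, inner_C2]
  ext i
  fin_cases i <;> simp [wedge] <;> ring

lemma norm_wedge_matOp (M : unimodularGL2) (x y : C2) :
    ‖wedge (matOp M x) (matOp M y)‖ = ‖wedge x y‖ := by
  have hM : ‖((M : GL (Fin 2) ℂ) : Matrix (Fin 2) (Fin 2) ℂ).det‖ = 1 := M.2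
  have : wedge (matOp M x) (matOp M y)
      = ((M : GL (Fin 2) ℂ) : Matrix (Fin 2) (Fin 2) ℂ).det * wedge x y := by
    rw [Matrix.det_fin_two]
    simp only [wedge, matOp_apply_zero, matOp_apply_one]
    ring
  rw [this, norm_mul, hM, one_mul]

/-- Areas are preserved, so contracting `v` by `t` must be paid for by stretching `perp v`. -/
lemma one_le_mul_norm_matOp (M : unimodularGL2) {v : C2} (hv : v ≠ 0) {t : ℝ}
    (h : ‖matOp M v‖ ≤ t * ‖v‖) : 1 ≤ t * ‖matOp M‖ := by
  have hv' : 0 < ‖v‖ := norm_pos_iff.2 hv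
  have h1 : ‖v‖ ^ 2 = ‖wedge (matOp M v) (matOp M (perp v))‖ := by
    rw [norm_wedge_matOp, wedge_perp]; simp
  have h2 : ‖v‖ ^ 2 ≤ (t * ‖v‖) * (‖matOp M‖ * ‖v‖) := by
    rw [h1]
    refine (norm_wedge_le _ _).trans ?_
    have := (matOp M).le_opNorm (perp v)
    rw [norm_perp] at this
    exact mul_le_mul h this (norm_nonneg _) ((norm_nonneg _).trans h)
  by_contra! hlt
  nlinarith [mul_pos hv' hv']

/-- If every unit vector were stretched, the inverse would strictly contract both basis vectors and
hence shrink the area they span. -/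
lemma exists_unit_norm_matOp_le (M : unimodularGL2) : ∃ s : C2, ‖s‖ = 1 ∧ ‖matOp M s‖ ≤ 1 := by
  by_contra! h
  have hlt : ∀ w : C2, ‖w‖ = 1 → ‖matOp M⁻¹ w‖ < 1 := by
    intro w hw
    by_contra! hge
    have hpos : 0 < ‖matOp M⁻¹ w‖ := by linarith
    have h1 := h (((‖matOp M⁻¹ w‖⁻¹ : ℝ) : ℂ) • matOp M⁻¹ w) (by
      rw [norm_smul]; simp; field_simp)
    rw [map_smul, matOp_apply_inv_self, norm_smul, hw] at h1
    simp only [Complex.norm_real, norm_inv, norm_norm, mul_one] at h1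
    have := inv_le_one_of_one_le₀ hge
    linarith
  have e0 : ‖(!₂[1, 0] : C2)‖ = 1 := by
    rw [← sq_eq_sq₀ (norm_nonneg _) zero_le_one, C2.norm_sq]; simp
  have e1 : ‖(!₂[0, 1] : C2)‖ = 1 := by
    rw [← sq_eq_sq₀ (norm_nonneg _) zero_le_one, C2.norm_sq]; simp
  have hw := norm_wedge_matOp M⁻¹ !₂[1, 0] !₂[0, 1]
  have hle := norm_wedge_le (matOp M⁻¹ !₂[1, 0]) (matOp M⁻¹ !₂[0, 1])
  rw [hw] at hle
  simp only [wedge] at hle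
  have h0 := hlt _ e0
  have h1 := hlt _ e1
  have := mul_lt_one_of_nonneg_of_lt_one_left (norm_nonneg (matOp M⁻¹ !₂[1, 0])) h0 h1.le
  simp at hle
  linarith

/-! ### Cocycle iterates: the group law, continuity and a priori bounds. -/

section Iterates

variable {Ω : Type*} [MetricSpace Ω] (T : Ω ≃ₜ Ω) (A : Ω → unimodularGL2)

lemma Homeomorph.zpow_add_apply (m n : ℤ) (ω : Ω) : (T ^ (m + n)) ω = (T ^ m) ((T ^ n) ω) := by
  rw [zpow_add]; rfl

@[simp] lemma cocycleIter_zero (ω : Ω) : cocycleIter T A 0 ω = 1 := rfl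

lemma cocycleIter_add_one (n : ℤ) (ω : Ω) :
    cocycleIter T A (n + 1) ω = A ((T ^ n) ω) * cocycleIter T A n ω := by
  rcases n with n | n
  · rfl
  · rcases n with _ | n
    · change (1 : unimodularGL2) = A ((T ^ (-1 : ℤ)) ω) *
        ((A ((T ^ (-(((0 : ℕ) : ℤ) + 1))) ω))⁻¹ * 1)
      simp
    · have h : Int.negSucc (n + 1) + 1 = Int.negSucc n := by omega
      rw [h]
      change cocycleBackward T A (n + 1) ω = A _ * ((A ((T ^ (-(((n + 1 : ℕ) : ℤ) + 1))) ω))⁻¹ *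
        cocycleBackward T A (n + 1) ω)
      have h' : Int.negSucc (n + 1) = -(((n + 1 : ℕ) : ℤ) + 1) := by omega
      rw [h', mul_inv_cancel_left]

lemma cocycleIter_one (ω : Ω) : cocycleIter T A 1 ω = A ω := by
  have := cocycleIter_add_one T A 0 ω
  simpa using this

lemma cocycleIter_sub_one (n : ℤ) (ω : Ω) :
    cocycleIter T A (n - 1) ω = (A ((T ^ (n - 1)) ω))⁻¹ * cocycleIter T A n ω := by
  have := cocycleIter_add_one T A (n - 1) ω
  rw [sub_add_cancel] at this
  rw [this, inv_mul_cancel_left]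

lemma cocycleIter_add (m n : ℤ) (ω : Ω) :
    cocycleIter T A (m + n) ω = cocycleIter T A m ((T ^ n) ω) * cocycleIter T A n ω := by
  induction m with
  | zero => simp
  | succ i ih =>
    rw [show (i : ℤ) + 1 + n = (i + n) + 1 by ring, cocycleIter_add_one, ih, cocycleIter_add_one,
      Homeomorph.zpow_add_apply, mul_assoc]
  | pred i ih =>
    rw [show -(i : ℤ) - 1 + n = (-i + n) - 1 by ring, cocycleIter_sub_one, ih, cocycleIter_sub_one,
      show -(i : ℤ) + n - 1 = (-i - 1) + n by ring, Homeomorph.zpow_add_apply, mul_assoc]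

lemma cocycleIter_add_apply (m n : ℤ) (ω : Ω) (v : C2) :
    matOp (cocycleIter T A (m + n) ω) v =
      matOp (cocycleIter T A m ((T ^ n) ω)) (matOp (cocycleIter T A n ω) v) := by
  rw [cocycleIter_add, matOp_mul_apply]

variable {A}

lemma continuous_cocycleIter (hA : Continuous A) (n : ℤ) : Continuous (cocycleIter T A n) := by
  induction n with
  | zero => exact continuous_const
  | succ i ih =>
    have : cocycleIter T A (i + 1) = fun ω => A ((T ^ (i : ℤ)) ω) * cocycleIter T A i ω :=
      funext fun ω => cocycleIter_add_one T A i ω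
    rw [this]
    exact (hA.comp (T ^ (i : ℤ)).continuous).mul ih
  | pred i ih =>
    have : cocycleIter T A (-i - 1) =
        fun ω => (A ((T ^ (-(i : ℤ) - 1)) ω))⁻¹ * cocycleIter T A (-i) ω :=
      funext fun ω => cocycleIter_sub_one T A (-i) ω
    rw [this]
    exact (hA.comp (T ^ (-(i : ℤ) - 1)).continuous).inv.mul ih

lemma continuous_cocycleIter_apply (hA : Continuous A) (n : ℤ) :
    Continuous fun p : Ω × C2 => matOp (cocycleIter T A n p.1) p.2 :=
  (continuous_matOp.comp ((continuous_cocycleIter T hA n).comp continuous_fst)).clm_apply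
    continuous_snd

/-- `K` bounds the cocycle and its inverse. -/
def CocycleBound (A : Ω → unimodularGL2) (K : ℝ) : Prop :=
  1 ≤ K ∧ ∀ (ω : Ω) (v : C2), ‖matOp (A ω) v‖ ≤ K * ‖v‖ ∧ ‖matOp (A ω)⁻¹ v‖ ≤ K * ‖v‖

lemma exists_cocycleBound [CompactSpace Ω] (hA : Continuous A) : ∃ K, CocycleBound A K := by
  obtain ⟨K₁, h₁⟩ := isCompact_univ.exists_bound_of_continuousOn
    (continuous_matOp.comp hA).continuousOn
  obtain ⟨K₂, h₂⟩ := isCompact_univ.exists_bound_of_continuousOn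
    (continuous_matOp.comp hA.inv).continuousOn
  refine ⟨max 1 (max K₁ K₂), le_max_left _ _, fun ω v => ⟨?_, ?_⟩⟩
  · refine (ContinuousLinearMap.le_opNorm _ v).trans ?_
    gcongr
    exact (h₁ ω trivial).trans (by simp)
  · refine (ContinuousLinearMap.le_opNorm _ v).trans ?_
    gcongr
    exact (h₂ ω trivial).trans (by simp)

variable {T}

lemma CocycleBound.norm_iter_le {K : ℝ} (hK : CocycleBound A K) (n : ℤ) (ω : Ω) (v : C2) :
    ‖matOp (cocycleIter T A n ω) v‖ ≤ K ^ n.natAbs * ‖v‖ := by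
  have hK0 : 0 ≤ K := zero_le_one.trans hK.1
  induction n with
  | zero => simp [matOp_one_apply]
  | succ i ih =>
    rw [cocycleIter_add_one, matOp_mul_apply]
    refine ((hK.2 _ _).1.trans (mul_le_mul_of_nonneg_left ih hK0)).trans_eq ?_
    rw [show ((i : ℤ) + 1).natAbs = i + 1 by omega, Int.natAbs_natCast, pow_succ]
    ring
  | pred i ih =>
    rw [cocycleIter_sub_one, matOp_mul_apply]
    refine ((hK.2 _ _).2.trans (mul_le_mul_of_nonneg_left ih hK0)).trans_eq ?_
    rw [show (-(i : ℤ) - 1).natAbs = i + 1 by omega, Int.natAbs_neg, Int.natAbs_natCast, pow_succ]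
    ring

lemma CocycleBound.norm_iter_le_of_le {K : ℝ} (hK : CocycleBound A K) {n : ℤ} {N : ℕ}
    (hn : n.natAbs ≤ N) (ω : Ω) (v : C2) :
    ‖matOp (cocycleIter T A n ω) v‖ ≤ K ^ N * ‖v‖ :=
  (hK.norm_iter_le n ω v).trans
    (mul_le_mul_of_nonneg_right (pow_le_pow_right₀ hK.1 hn) (norm_nonneg _))

end Iterates

/-! ### Bounded orbits and exponential splittings -/

section Dynamics

variable {Ω : Type*} [MetricSpace Ω] {T : Ω ≃ₜ Ω} {A : Ω → unimodularGL2}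

/-- Cantor's intersection theorem on the compact product of `Ω` with the unit sphere; it turns
finite-time bounds into bounds for all times. -/
lemma exists_unit_mem_of_antitone [CompactSpace Ω] {F : ℕ → Set (Ω × C2)}
    (hF : ∀ n, IsClosed (F n)) (hanti : ∀ n, F (n + 1) ⊆ F n)
    (hne : ∀ n, ∃ ω v, ‖v‖ = 1 ∧ (ω, v) ∈ F n) : ∃ ω v, ‖v‖ = 1 ∧ ∀ n, (ω, v) ∈ F n := by
  have hK : IsCompact ((Set.univ : Set Ω) ×ˢ Metric.sphere (0 : C2) 1) :=
    isCompact_univ.prod (isCompact_sphere _ _)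
  obtain ⟨⟨ω, v⟩, h⟩ := IsCompact.nonempty_iInter_of_sequence_nonempty_isCompact_isClosed
    (fun n => F n ∩ ((Set.univ : Set Ω) ×ˢ Metric.sphere (0 : C2) 1))
    (fun n => Set.inter_subset_inter_left _ (hanti n))
    (fun n => by
      obtain ⟨ω, v, hv, h⟩ := hne n
      exact ⟨(ω, v), h, by simpa using hv⟩)
    (hK.inter_left (hF 0)) (fun n => (hF n).inter hK.isClosed)
  rw [Set.mem_iInter] at h
  exact ⟨ω, v, by simpa using (h 0).2, fun n => (h n).1⟩

lemma isClosed_norm_iter_le (hA : Continuous A) (p : ℤ → Prop) (B : ℝ) :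
    IsClosed {x : Ω × C2 | ∀ k : ℤ, p k → ‖matOp (cocycleIter T A k x.1) x.2‖ ≤ B} := by
  simp only [Set.ofPred_forall]
  exact isClosed_iInter fun k => isClosed_iInter fun _ =>
    isClosed_le (continuous_cocycleIter_apply T hA k).norm continuous_const

/-- A nonzero bounded orbit gives rise to a Sacker-Sell solution. -/
lemma hasSackerSell_of_bounded [CompactSpace Ω] (hA : Continuous A) {ω : Ω} {v : C2} (hv : v ≠ 0)
    {B : ℝ} (hB : ∀ n : ℤ, ‖matOp (cocycleIter T A n ω) v‖ ≤ B) : HasSackerSell T A := by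
  set a : ℤ → ℝ := fun n => ‖matOp (cocycleIter T A n ω) v‖ with ha
  have hbdd : BddAbove (Set.range a) := ⟨B, by rintro _ ⟨n, rfl⟩; exact hB n⟩
  set s : ℝ := ⨆ n, a n with hs
  have ha0 : 0 < a 0 := norm_pos_iff.2 (matOp_ne_zero _ hv)
  have hspos : 0 < s := ha0.trans_le (le_ciSup hbdd 0)
  let F : ℕ → Set (Ω × C2) := fun N =>
    {x | ∀ k : ℤ, True → ‖matOp (cocycleIter T A k x.1) x.2‖ ≤ 1 + 1 / ((N : ℝ) + 1)}
  obtain ⟨ω', v', hv', h⟩ := exists_unit_mem_of_antitone (F := F)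
    (fun N => isClosed_norm_iter_le hA _ _)
    (fun N x hx k _ => (hx k trivial).trans (by push_cast; gcongr; linarith))
    (fun N => by
      have hN : (0 : ℝ) < 1 / ((N : ℝ) + 1) := by positivity
      -- Restarting the orbit at a time where its norm nearly attains the supremum, and normalizing
      -- there, leaves all other norms at most `1 + 1 / (N + 1)`.
      obtain ⟨n, hn⟩ := exists_lt_of_lt_ciSup (f := a)
        (show s / (1 + 1 / ((N : ℝ) + 1)) < s from div_lt_self hspos (by linarith))
      have hn0 : 0 < a n := lt_trans (by positivity) hn
      refine ⟨(T ^ n) ω, (((a n)⁻¹ : ℝ) : ℂ) • matOp (cocycleIter T A n ω) v, ?_, fun k _ => ?_⟩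
      · rw [norm_smul, Complex.norm_real, Real.norm_of_nonneg (by positivity)]
        exact inv_mul_cancel₀ hn0.ne'
      · simp only [map_smul, ← cocycleIter_add_apply]
        rw [norm_smul, Complex.norm_real, Real.norm_of_nonneg (by positivity)]
        have h1 : a (k + n) ≤ s := le_ciSup hbdd _
        rw [div_lt_iff₀ (by positivity)] at hn
        rw [inv_mul_le_iff₀ hn0]
        exact h1.trans hn.le)
  refine ⟨ω', v', hv', fun n => ?_⟩
  have ht : Filter.Tendsto (fun N : ℕ => 1 + 1 / ((N : ℝ) + 1)) Filter.atTop (nhds (1 + 0)) :=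
    tendsto_const_nhds.add tendsto_one_div_add_atTop_nhds_zero_nat
  rw [add_zero] at ht
  exact ge_of_tendsto' ht fun N => h N n trivial

/-- Every vector at least doubles in norm at some time `k` with `|k| ≤ N`. -/
def DoublesWithin (T : Ω ≃ₜ Ω) (A : Ω → unimodularGL2) (N : ℕ) : Prop :=
  ∀ (ω : Ω) (v : C2), ∃ k : ℤ, k.natAbs ≤ N ∧ 2 * ‖v‖ ≤ ‖matOp (cocycleIter T A k ω) v‖

/-- Otherwise there are unit vectors whose orbits stay below 2 on ever longer windows, and a limit
of them is a bounded orbit. -/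
lemma exists_doublesWithin [CompactSpace Ω] (hA : Continuous A) (h : ¬ HasSackerSell T A) :
    ∃ N, 0 < N ∧ DoublesWithin T A N := by
  by_contra! hcon
  apply h
  let F : ℕ → Set (Ω × C2) := fun N =>
    {x | ∀ k : ℤ, k.natAbs ≤ N + 1 → ‖matOp (cocycleIter T A k x.1) x.2‖ ≤ 2}
  obtain ⟨ω, v, hv, h⟩ := exists_unit_mem_of_antitone (F := F)
    (fun N => isClosed_norm_iter_le hA _ _)
    (fun N x hx k hk => hx k (by omega))
    (fun N => by
      have := hcon (N + 1) (by omega)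
      simp only [DoublesWithin, not_forall, not_exists, not_and, not_le] at this
      obtain ⟨ω, v, hv⟩ := this
      have hv0 : 0 < ‖v‖ := by
        -- Time `0` gives `‖v‖ < 2 * ‖v‖`, so `v` is nonzero.
        have := hv 0 (by simp)
        rw [cocycleIter_zero, matOp_one_apply] at this
        by_contra! h0
        linarith [norm_nonneg v]
      refine ⟨ω, ((‖v‖⁻¹ : ℝ) : ℂ) • v, ?_, fun k hk => ?_⟩
      · rw [norm_smul, Complex.norm_real, Real.norm_of_nonneg (by positivity)]
        exact inv_mul_cancel₀ hv0.ne'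
      · simp only [map_smul]
        rw [norm_smul, Complex.norm_real, Real.norm_of_nonneg (by positivity),
          inv_mul_le_iff₀ hv0, mul_comm]
        exact (hv k hk).le)
  refine hasSackerSell_of_bounded hA (v := v) (ω := ω) (B := 2) ?_ fun n => h n.natAbs n (by omega)
  rintro rfl
  simp at hv

/-! ### From doubling to exponential decay on half-lines. -/

lemma le_half_pow_of_doubling {a : ℕ → ℝ} {N : ℕ} {B : ℝ} (hB : ∀ n, a n ≤ B)
    (h : ∀ n, N ≤ n → ∃ m, n ≤ m + N ∧ 2 * a n ≤ a m) (j n : ℕ) (hn : j * N ≤ n) :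
    a n ≤ B / 2 ^ j := by
  induction j generalizing n with
  | zero => simpa using hB n
  | succ j ih =>
    rw [Nat.succ_mul] at hn
    -- Each doubling moves back by at most `N`, so `j` of them fit before the index drops below `0`;
    -- moving forward does no harm.
    obtain ⟨m, hm, hle⟩ := h n (by omega)
    have := ih m (by omega)
    rw [pow_succ, ← div_div]
    linarith

/-- The supremum cannot come from indices beyond `N`, where every value is at most half of it. -/
lemma le_of_bounded_of_doubling {a : ℕ → ℝ} {N : ℕ} {B D : ℝ} (hB : ∀ n, a n ≤ B)
    (ha : ∀ n, 0 ≤ a n)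
    (h : ∀ n, N ≤ n → ∃ m, n ≤ m + N ∧ 2 * a n ≤ a m) (hD : ∀ n, n ≤ N → a n ≤ D) (n : ℕ) :
    a n ≤ D := by
  have hbdd : BddAbove (Set.range a) := ⟨B, by rintro _ ⟨n, rfl⟩; exact hB n⟩
  have hD0 : 0 ≤ D := (ha 0).trans (hD 0 (by omega))
  have hs : (⨆ n, a n) ≤ max ((⨆ n, a n) / 2) D := by
    refine ciSup_le fun n => ?_
    rcases le_total n N with hn | hn
    · exact (hD n hn).trans (le_max_right _ _)
    · obtain ⟨m, -, hm⟩ := h n hn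
      have := le_ciSup hbdd m
      exact le_max_of_le_left (by linarith)
  have hle := le_ciSup hbdd n
  rcases le_max_iff.1 hs with h1 | h1
  · linarith
  · linarith

/-- The vectors whose orbits stay bounded in the time direction `e`. -/
def boundedSubmodule (T : Ω ≃ₜ Ω) (A : Ω → unimodularGL2) (e : ℤ) (ω : Ω) : Submodule ℂ C2 where
  carrier := {v | ∃ B : ℝ, ∀ n : ℕ, ‖matOp (cocycleIter T A (e * n) ω) v‖ ≤ B}
  zero_mem' := ⟨0, fun n => by simp⟩
  add_mem' := by
    rintro v w ⟨B, hB⟩ ⟨B', hB'⟩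
    exact ⟨B + B', fun n => by
      rw [map_add]; exact (norm_add_le _ _).trans (add_le_add (hB n) (hB' n))⟩
  smul_mem' := by
    rintro c v ⟨B, hB⟩
    exact ⟨‖c‖ * B, fun n => by
      rw [map_smul, norm_smul]; exact mul_le_mul_of_nonneg_left (hB n) (norm_nonneg _)⟩

lemma mem_boundedSubmodule {e : ℤ} {ω : Ω} {v : C2} : v ∈ boundedSubmodule T A e ω ↔
    ∃ B : ℝ, ∀ n : ℕ, ‖matOp (cocycleIter T A (e * n) ω) v‖ ≤ B := Iff.rfl

lemma map_mem_boundedSubmodule_iff {K : ℝ} (hK : CocycleBound A K) (e : ℤ) (ω : Ω) (v : C2) :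
    matOp (A ω) v ∈ boundedSubmodule T A e (T ω) ↔ v ∈ boundedSubmodule T A e ω := by
  have hK0 : 0 ≤ K := zero_le_one.trans hK.1
  have key : ∀ n : ℤ, matOp (cocycleIter T A n (T ω)) (matOp (A ω) v) =
      matOp (A ((T ^ n) ω)) (matOp (cocycleIter T A n ω) v) := fun n => by
    have h1 := cocycleIter_add_apply T A n 1 ω v
    have h2 := cocycleIter_add_one T A n ω
    rw [cocycleIter_one, h2, matOp_mul_apply, zpow_one] at h1
    exact h1.symm
  simp only [mem_boundedSubmodule, key]
  constructor
  · rintro ⟨B, hB⟩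
    refine ⟨K * B, fun n => ?_⟩
    have := (hK.2 ((T ^ (e * (n : ℤ))) ω) (matOp (A ((T ^ (e * (n : ℤ))) ω))
      (matOp (cocycleIter T A (e * n) ω) v))).2
    rw [matOp_inv_apply_self] at this
    exact this.trans (mul_le_mul_of_nonneg_left (hB n) hK0)
  · rintro ⟨B, hB⟩
    exact ⟨K * B, fun n => (hK.2 _ _).1.trans (mul_le_mul_of_nonneg_left (hB n) hK0)⟩

lemma map_boundedSubmodule {K : ℝ} (hK : CocycleBound A K) (e : ℤ) (ω : Ω) :
    (boundedSubmodule T A e ω).map (matOp (A ω)).toLinearMap = boundedSubmodule T A e (T ω) := by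
  ext w
  constructor
  · rintro ⟨v, hv, rfl⟩
    exact (map_mem_boundedSubmodule_iff hK e ω v).2 hv
  · intro hw
    refine ⟨matOp (A ω)⁻¹ w, ?_, matOp_apply_inv_self _ _⟩
    refine (map_mem_boundedSubmodule_iff hK e ω _).1 ?_
    rwa [matOp_apply_inv_self]

lemma DoublesWithin.exists_shift {N : ℕ} (hN : DoublesWithin T A N) {e : ℤ} (he : e.natAbs = 1)
    (ω : Ω) (v : C2) (n : ℕ) (hn : N ≤ n) : ∃ m : ℕ, n ≤ m + N ∧ m ≤ n + N ∧
      2 * ‖matOp (cocycleIter T A (e * n) ω) v‖ ≤ ‖matOp (cocycleIter T A (e * m) ω) v‖ := by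
  obtain ⟨k, hk, h⟩ := hN ((T ^ (e * (n : ℤ))) ω) (matOp (cocycleIter T A (e * n) ω) v)
  rw [← cocycleIter_add_apply] at h
  rcases Int.natAbs_eq_iff.1 he with rfl | rfl
  -- Since `n ≥ N`, the shifted time stays on the same half-line and `toNat` loses nothing.
  · refine ⟨(n + k).toNat, by omega, by omega, ?_⟩
    convert h using 5
    omega
  · refine ⟨(n - k).toNat, by omega, by omega, ?_⟩
    convert h using 5
    omega

lemma CocycleBound.norm_iter_mul_le {K : ℝ} (hK : CocycleBound A K) {e : ℤ} (he : e.natAbs = 1)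
    {n N : ℕ} (hn : n ≤ N) (ω : Ω) (v : C2) :
    ‖matOp (cocycleIter T A (e * n) ω) v‖ ≤ K ^ N * ‖v‖ :=
  hK.norm_iter_le_of_le (by rw [Int.natAbs_mul, he]; simpa using hn) ω v

/-- The unknown bound `B` is first replaced by the uniform constant `K ^ N * ‖v‖`; doubling then
yields decay at a rate independent of `ω` and `v`. -/
lemma norm_iter_le_of_mem_boundedSubmodule {K : ℝ} (hK : CocycleBound A K) {N : ℕ}
    (hN : DoublesWithin T A N) {e : ℤ} (he : e.natAbs = 1) {ω : Ω} {v : C2}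
    (hv : v ∈ boundedSubmodule T A e ω) (n : ℕ) :
    ‖matOp (cocycleIter T A (e * n) ω) v‖ ≤ K ^ N * ‖v‖ / 2 ^ (n / N) := by
  obtain ⟨B, hB⟩ := hv
  have hd : ∀ n : ℕ, N ≤ n → ∃ m : ℕ, n ≤ m + N ∧
      2 * ‖matOp (cocycleIter T A (e * n) ω) v‖ ≤ ‖matOp (cocycleIter T A (e * m) ω) v‖ :=
    fun n hn => by
      obtain ⟨m, h1, -, h2⟩ := hN.exists_shift he ω v n hn
      exact ⟨m, h1, h2⟩
  exact le_half_pow_of_doubling (a := fun n : ℕ => ‖matOp (cocycleIter T A (e * n) ω) v‖)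
    (le_of_bounded_of_doubling hB (fun n => norm_nonneg _) hd
      (fun n hn => hK.norm_iter_mul_le he hn ω v)) hd _ _ (Nat.div_mul_le_self n N)

/-- With `L = 2 ^ (1 / N)`, the factor 2 absorbs the rounding in `n / N`. -/
lemma inv_two_pow_div_le {N : ℕ} (hN : 0 < N) :
    ∃ L : ℝ, 1 < L ∧ ∀ n : ℕ, ((2 : ℝ) ^ (n / N))⁻¹ ≤ 2 * (L ^ n)⁻¹ := by
  refine ⟨(2 : ℝ) ^ ((N : ℝ)⁻¹), Real.one_lt_rpow (by norm_num) (by positivity), fun n => ?_⟩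
  have hL1 : 1 ≤ (2 : ℝ) ^ ((N : ℝ)⁻¹) := Real.one_le_rpow (by norm_num) (by positivity)
  have hLN : ((2 : ℝ) ^ ((N : ℝ)⁻¹)) ^ N = 2 := Real.rpow_inv_natCast_pow (by norm_num) hN.ne'
  have h : ((2 : ℝ) ^ ((N : ℝ)⁻¹)) ^ n ≤ 2 * 2 ^ (n / N) := by
    calc ((2 : ℝ) ^ ((N : ℝ)⁻¹)) ^ n ≤ ((2 : ℝ) ^ ((N : ℝ)⁻¹)) ^ (N * (n / N + 1)) :=
          pow_le_pow_right₀ hL1 (Nat.lt_mul_div_succ n hN).le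
      _ = 2 * 2 ^ (n / N) := by rw [pow_mul, hLN, pow_succ]; ring
  rw [inv_le_iff_one_le_mul₀ (by positivity), mul_assoc, mul_comm (_)⁻¹, ← mul_assoc,
    ← div_eq_mul_inv, one_le_div (by positivity)]
  exact h

lemma exists_unit_mem_boundedSubmodule [CompactSpace Ω] (hA : Continuous A) {K : ℝ}
    (hK : CocycleBound A K) {N : ℕ} (hN : DoublesWithin T A N) {e : ℤ} (he : e.natAbs = 1)
    (ω : Ω) : ∃ v ∈ boundedSubmodule T A e ω, ‖v‖ = 1 := by
  have hKN : 1 ≤ K ^ N := one_le_pow₀ hK.1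
  let F : ℕ → Set (Ω × C2) := fun n =>
    {x | ∀ k : ℤ, (∃ i : ℕ, i ≤ n ∧ k = e * i) → ‖matOp (cocycleIter T A k x.1) x.2‖ ≤ K ^ N} ∩
      {x | x.1 = ω}
  obtain ⟨ω', v, hv, h⟩ := exists_unit_mem_of_antitone (F := F)
    (fun n => (isClosed_norm_iter_le hA _ _).inter (isClosed_eq continuous_fst continuous_const))
    (fun n x hx => ⟨fun k ⟨i, hi, hk⟩ => hx.1 k ⟨i, by omega, hk⟩, hx.2⟩)
    (fun n => by
      -- Take a unit vector that is not stretched at the final time `n`, and let `j` be the time of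
      -- its largest norm up to `n`. Near either end that norm is at most `K ^ N`; in the middle,
      -- doubling would contradict maximality.
      obtain ⟨s, hs, hsn⟩ := exists_unit_norm_matOp_le (cocycleIter T A (e * n) ω)
      refine ⟨ω, s, hs, ?_, rfl⟩
      rintro _ ⟨i, hi, rfl⟩
      obtain ⟨j, hj, hmax⟩ := Finset.exists_max_image (Finset.range (n + 1))
        (fun i : ℕ => ‖matOp (cocycleIter T A (e * i) ω) s‖) ⟨0, by simp⟩
      rw [Finset.mem_range] at hj
      refine (hmax i (Finset.mem_range.2 (by omega))).trans ?_
      rcases le_total j N with hjN | hjN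
      · simpa [hs] using hK.norm_iter_mul_le he hjN ω s
      · rcases le_total (j + N) n with hjn | hjn
        · obtain ⟨m, -, hm, h2⟩ := hN.exists_shift he ω s j hjN
          have h3 := hmax m (Finset.mem_range.2 (by omega))
          have h4 : ‖matOp (cocycleIter T A (e * j) ω) s‖ ≤ 0 := by linarith
          linarith
        · have h1 := cocycleIter_add_apply T A (e * j - e * n) (e * n) ω s
          rw [sub_add_cancel] at h1
          simp only [h1]
          refine (hK.norm_iter_le_of_le (N := N) ?_ _ _).trans
            (mul_le_of_le_one_right (by positivity) hsn)
          rw [← mul_sub, Int.natAbs_mul, he]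
          omega)
  obtain rfl : ω' = ω := (h 0).2
  exact ⟨v, ⟨K ^ N, fun n => (h n).1 _ ⟨n, le_rfl, rfl⟩⟩, hv⟩

/-- The dimension is not two, since a contraction of the whole plane would violate area
preservation. -/
lemma finrank_boundedSubmodule [CompactSpace Ω] (hA : Continuous A) {K : ℝ}
    (hK : CocycleBound A K) {N : ℕ} (hN0 : 0 < N) (hN : DoublesWithin T A N) {e : ℤ}
    (he : e.natAbs = 1) (ω : Ω) : Module.finrank ℂ (boundedSubmodule T A e ω) = 1 := by
  obtain ⟨v, hv, hv1⟩ := exists_unit_mem_boundedSubmodule hA hK hN he ω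
  have hv0 : v ≠ 0 := by rintro rfl; simp at hv1
  have hbot : boundedSubmodule T A e ω ≠ ⊥ := fun h => hv0 (by simpa [h] using hv)
  have htop : boundedSubmodule T A e ω ≠ ⊤ := by
    intro h
    have hle : ∀ (n : ℕ) (x : C2), ‖matOp (cocycleIter T A (e * n) ω) x‖
        ≤ K ^ N * ‖x‖ / 2 ^ (n / N) := fun n x =>
      norm_iter_le_of_mem_boundedSubmodule hK hN he (by rw [h]; trivial) n
    obtain ⟨j, hj⟩ := pow_unbounded_of_one_lt (K ^ N) (one_lt_two : (1 : ℝ) < 2)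
    have hj' := hle (j * N)
    rw [Nat.mul_div_cancel _ hN0] at hj'
    have hK0 : 0 ≤ K := zero_le_one.trans hK.1
    have hlt : K ^ N / 2 ^ j < 1 := (div_lt_one (by positivity)).2 hj
    have hnn : 0 ≤ K ^ N / 2 ^ j := by positivity
    have h1 : ∀ x : C2, ‖matOp (cocycleIter T A (e * ↑(j * N)) ω) x‖ ≤ K ^ N / 2 ^ j * ‖x‖ :=
      fun x => (hj' x).trans_eq (by ring)
    have h2 := one_le_mul_norm_matOp _ hv0 (h1 v)
    have h3 : ‖matOp (cocycleIter T A (e * ↑(j * N)) ω)‖ ≤ K ^ N / 2 ^ j :=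
      ContinuousLinearMap.opNorm_le_bound _ hnn h1
    nlinarith
  have h1 : 0 < Module.finrank ℂ (boundedSubmodule T A e ω) :=
    Nat.pos_of_ne_zero fun h => hbot (Submodule.finrank_eq_zero.1 h)
  have h2 := Submodule.finrank_lt htop
  rw [finrank_euclideanSpace_fin] at h2
  omega

/-! ### Continuity of line fields and the invariant splitting. -/

lemma arccos_tendsto_of_tendsto {v : ℕ → C2} {w : C2} (hw : w ≠ 0)
    (h : Filter.Tendsto v Filter.atTop (nhds w)) :
    Filter.Tendsto (fun n => Real.arccos (‖inner ℂ (v n) w‖ / (‖v n‖ * ‖w‖))) Filter.atTop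
      (nhds 0) := by
  have hw' : ‖w‖ ≠ 0 := norm_ne_zero_iff.2 hw
  have h1 : Filter.Tendsto (fun n => ‖inner ℂ (v n) w‖ / (‖v n‖ * ‖w‖)) Filter.atTop
      (nhds (‖(inner ℂ w w : ℂ)‖ / (‖w‖ * ‖w‖))) :=
    (h.inner tendsto_const_nhds).norm.div (h.norm.mul_const _) (mul_ne_zero hw' hw')
  have h2 : ‖(inner ℂ w w : ℂ)‖ / (‖w‖ * ‖w‖) = 1 := by
    rw [inner_self_eq_norm_sq_to_K, norm_pow]
    simp
    field_simp
  rw [h2] at h1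
  rw [← Real.arccos_one]
  exact (Real.continuous_arccos.tendsto 1).comp h1

/-- A field of lines with closed graph is continuous. -/
lemma lineContinuous_of_isClosed {Λ : Ω → Projectivization ℂ C2} {R : Set (Ω × C2)}
    (hR : IsClosed R) (hmem : ∀ ω v, v ∈ (Λ ω).submodule → (ω, v) ∈ R)
    (hR' : ∀ ω v, (ω, v) ∈ R → v ∈ (Λ ω).submodule) : LineContinuous Λ := by
  intro ω ε hε
  by_contra! hcon
  choose ω' hω' hang using fun n : ℕ => hcon (1 / ((n : ℝ) + 1)) (by positivity)
  have hlim : Filter.Tendsto ω' Filter.atTop (nhds ω) := by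
    rw [tendsto_iff_dist_tendsto_zero]
    exact squeeze_zero (fun _ => dist_nonneg) (fun n => (hω' n).le)
      tendsto_one_div_add_atTop_nhds_zero_nat
  have hunit : ∀ x : Ω, ∃ v ∈ (Λ x).submodule, ‖v‖ = 1 := fun x => by
    refine ⟨((‖(Λ x).rep‖⁻¹ : ℝ) : ℂ) • (Λ x).rep, Submodule.smul_mem _ _ ?_, ?_⟩
    · rw [Projectivization.submodule_eq]
      exact Submodule.mem_span_singleton_self _
    · have : ‖(Λ x).rep‖ ≠ 0 := norm_ne_zero_iff.2 (Λ x).rep_nonzero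
      rw [norm_smul]
      simp [this]
  have hmk : ∀ (x : Ω) (v : C2) (hv : v ≠ 0), v ∈ (Λ x).submodule →
      Projectivization.mk ℂ v hv = Λ x := fun x v hv hvm => by
    apply Projectivization.submodule_injective
    rw [Projectivization.submodule_mk]
    rw [Projectivization.submodule_eq] at hvm ⊢
    obtain ⟨c, rfl⟩ := Submodule.mem_span_singleton.1 hvm
    have hc : c ≠ 0 := by rintro rfl; simp at hv
    exact Submodule.span_singleton_smul_eq (IsUnit.mk0 c hc) _
  choose v hv hv1 using fun n => hunit (ω' n)
  obtain ⟨w, hw, φ, hφ, hvw⟩ := (isCompact_sphere (0 : C2) 1).tendsto_subseq (x := v)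
    (fun n => by simpa using hv1 n)
  have hw1 : ‖w‖ = 1 := by simpa using hw
  have hw0 : w ≠ 0 := by rintro rfl; simp at hw1
  have hwmem : w ∈ (Λ ω).submodule := by
    refine hR' ω w (hR.mem_of_tendsto ((hlim.comp hφ.tendsto_atTop).prodMk_nhds hvw) ?_)
    exact Filter.Eventually.of_forall fun n => hmem _ _ (hv _)
  obtain ⟨n, hn⟩ := ((arccos_tendsto_of_tendsto hw0 hvw).eventually (gt_mem_nhds hε)).exists
  have hvn : v (φ n) ≠ 0 := by
    intro h
    have := hv1 (φ n)
    simp [h] at this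
  have := hang (φ n)
  rw [← hmk _ _ hvn (hv (φ n)), ← hmk _ _ hw0 hwmem, lineAngle_mk] at this
  simp only [Function.comp_apply] at hn
  linarith

/-- The sign `e = 1` gives the stable field, `e = -1` the unstable one. -/
lemma exists_line_decay [CompactSpace Ω] (hA : Continuous A) (h : ¬ HasSackerSell T A) {e : ℤ}
    (he : e.natAbs = 1) : ∃ (c L : ℝ) (Λ : Ω → Projectivization ℂ C2), 0 < c ∧ 1 < L ∧
      LineContinuous Λ ∧
      (∀ ω, (Λ ω).submodule.map (matOp (A ω)).toLinearMap = (Λ (T ω)).submodule) ∧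
      ∀ (n : ℕ) (ω : Ω), ∀ v ∈ (Λ ω).submodule,
        ‖matOp (cocycleIter T A (e * n) ω) v‖ ≤ c * (L ^ n)⁻¹ * ‖v‖ := by
  obtain ⟨K, hK⟩ := exists_cocycleBound hA
  obtain ⟨N, hN0, hN⟩ := exists_doublesWithin hA h
  obtain ⟨L, hL, hLn⟩ := inv_two_pow_div_le hN0
  have hK0 : 0 < K := zero_lt_one.trans_le hK.1
  let Λ : Ω → Projectivization ℂ C2 := fun ω =>
    Projectivization.mk'' (boundedSubmodule T A e ω) (finrank_boundedSubmodule hA hK hN0 hN he ω)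
  have hΛ : ∀ ω, (Λ ω).submodule = boundedSubmodule T A e ω := fun ω =>
    Projectivization.submodule_mk'' _ _
  refine ⟨K ^ N * 2, L, Λ, by positivity, hL, ?_, fun ω => ?_, fun n ω v hv => ?_⟩
  -- Because the bound `K ^ N` is uniform in `ω`, membership in the lines is a closed condition on
  -- pairs.
  · refine lineContinuous_of_isClosed
      (R := {x | ∀ n : ℕ, ‖matOp (cocycleIter T A (e * n) x.1) x.2‖ ≤ K ^ N * ‖x.2‖}) ?_ ?_ ?_
    · simp only [Set.ofPred_forall]
      exact isClosed_iInter fun n => isClosed_le (continuous_cocycleIter_apply T hA _).norm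
        (continuous_const.mul continuous_snd.norm)
    · intro ω v hv n
      rw [hΛ] at hv
      refine (norm_iter_le_of_mem_boundedSubmodule hK hN he hv n).trans
        (div_le_self (by positivity) (one_le_pow₀ one_le_two))
    · intro ω v hv
      rw [hΛ]
      exact ⟨_, hv⟩
  · rw [hΛ, hΛ, map_boundedSubmodule hK]
  · rw [hΛ] at hv
    refine (norm_iter_le_of_mem_boundedSubmodule hK hN he hv n).trans ?_
    rw [div_eq_mul_inv]
    calc K ^ N * ‖v‖ * (2 ^ (n / N))⁻¹ ≤ K ^ N * ‖v‖ * (2 * (L ^ n)⁻¹) := by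
          gcongr; exact hLn n
      _ = _ := by ring

theorem hasExpSplitting_of_not_hasSackerSell [CompactSpace Ω] (hA : Continuous A)
    (h : ¬ HasSackerSell T A) : HasExpSplitting T A := by
  obtain ⟨c₁, L₁, Λs, hc₁, hL₁, hs, hsi, hsd⟩ := exists_line_decay hA h (e := 1) rfl
  obtain ⟨c₂, L₂, Λu, hc₂, hL₂, hu, hui, hud⟩ := exists_line_decay hA h (e := -1) rfl
  have hmono : ∀ (c L : ℝ) (n : ℕ) (x : ℝ), 0 ≤ x → c ≤ max c₁ c₂ → 0 ≤ c → min L₁ L₂ ≤ L →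
      c * (L ^ n)⁻¹ * x ≤ max c₁ c₂ * ((min L₁ L₂) ^ n)⁻¹ * x := by
    intro c L n x hx hc hc0 hL
    have h0 : 0 < min L₁ L₂ := lt_min (by linarith) (by linarith)
    have hL0 : 0 ≤ (L ^ n)⁻¹ := inv_nonneg.2 (pow_nonneg (h0.le.trans hL) n)
    gcongr
  refine ⟨max c₁ c₂, min L₁ L₂, Λs, Λu, lt_max_of_lt_left hc₁, lt_min hL₁ hL₂, hs, hu,
    fun ω => ⟨hsi ω, hui ω⟩, fun n ω _ => ⟨fun v hv => ?_, fun v hv => ?_⟩⟩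
  · have := hsd n ω v hv
    rw [one_mul] at this
    exact this.trans (hmono _ _ _ _ (norm_nonneg _) (le_max_left _ _) hc₁.le (min_le_left _ _))
  · have := hud n ω v hv
    rw [neg_one_mul] at this
    exact this.trans (hmono _ _ _ _ (norm_nonneg _) (le_max_right _ _) hc₂.le (min_le_right _ _))

theorem uniformExpGrowth_of_hasExpSplitting (h : HasExpSplitting T A) : UniformExpGrowth T A := by
  obtain ⟨c, L, Λs, Λu, hc, hL, -, -, -, hd⟩ := h
  have hrep : ∀ V : Projectivization ℂ C2, V.rep ∈ V.submodule := fun V => by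
    rw [Projectivization.submodule_eq]
    exact Submodule.mem_span_singleton_self _
  have hL0 : 0 < L := by linarith
  have hbase : ∀ (n : ℕ) (m : ℤ) (ω : Ω) (v : C2), v ≠ 0 →
      ‖matOp (cocycleIter T A m ω) v‖ ≤ c * (L ^ n)⁻¹ * ‖v‖ →
      min 1 c⁻¹ * L ^ n ≤ ‖matOp (cocycleIter T A m ω)‖ := by
    intro n m ω v hv hle
    have h1 := one_le_mul_norm_matOp _ hv hle
    have h2 : c⁻¹ * L ^ n ≤ ‖matOp (cocycleIter T A m ω)‖ := by
      rw [mul_assoc, inv_mul_eq_div, mul_div_assoc', one_le_div (by positivity)] at h1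
      rw [inv_mul_le_iff₀ hc]
      exact h1
    exact (mul_le_mul_of_nonneg_right (min_le_right _ _) (by positivity)).trans h2
  -- The minimum with 1 covers `n = 0`, where the splitting gives no estimate.
  refine ⟨min 1 c⁻¹, L, lt_min one_pos (inv_pos.2 hc), hL, fun n ω => ?_⟩
  obtain ⟨m, rfl | rfl⟩ := n.eq_nat_or_neg
  · rcases Nat.eq_zero_or_pos m with rfl | hm
    · have h1 : ‖matOp (1 : unimodularGL2)‖ = 1 := by
        have : matOp (1 : unimodularGL2) = ContinuousLinearMap.id ℂ C2 :=
          ContinuousLinearMap.ext matOp_one_apply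
        rw [this, ContinuousLinearMap.norm_id]
      simp [h1]
    · rw [Int.natAbs_natCast]
      exact hbase _ _ _ _ (Λs ω).rep_nonzero ((hd m ω hm).1 _ (hrep _))
  · rcases Nat.eq_zero_or_pos m with rfl | hm
    · have h1 : ‖matOp (1 : unimodularGL2)‖ = 1 := by
        have : matOp (1 : unimodularGL2) = ContinuousLinearMap.id ℂ C2 :=
          ContinuousLinearMap.ext matOp_one_apply
        rw [this, ContinuousLinearMap.norm_id]
      simp [h1]
    · rw [Int.natAbs_neg, Int.natAbs_natCast]
      exact hbase _ _ _ _ (Λu ω).rep_nonzero ((hd m ω hm).2 _ (hrep _))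

end Dynamics

/-! ### Exponential growth excludes bounded orbits -/

/-- The vector `w ⟂ v` with `wedge v w = 1`. -/
def dualPerp (v : C2) : C2 := ((‖v‖ : ℂ) ^ 2)⁻¹ • perp v

lemma norm_dualPerp (v : C2) : ‖dualPerp v‖ = ‖v‖⁻¹ := by
  rw [dualPerp, norm_smul, norm_perp, norm_inv, norm_pow, Complex.norm_real, norm_norm]
  rcases eq_or_ne ‖v‖ 0 with h | h
  · simp [h]
  · field_simp

lemma wedge_smul_right (v x : C2) (c : ℂ) : wedge v (c • x) = c * wedge v x := by
  simp [wedge]; ring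

lemma wedge_dualPerp {v : C2} (hv : v ≠ 0) : wedge v (dualPerp v) = 1 := by
  have : (‖v‖ : ℂ) ≠ 0 := by exact_mod_cast norm_ne_zero_iff.2 hv
  rw [dualPerp, wedge_smul_right, wedge_perp]
  field_simp

lemma eq_smul_add_smul_dualPerp {v : C2} (hv : v ≠ 0) (x : C2) :
    x = ((inner ℂ v x : ℂ) * ((‖v‖ : ℂ) ^ 2)⁻¹) • v + wedge v x • dualPerp v := by
  have h0 : (‖v‖ : ℂ) ^ 2 ≠ 0 := pow_ne_zero _ (by exact_mod_cast norm_ne_zero_iff.2 hv)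
  have h := congrArg (fun y => ((‖v‖ : ℂ) ^ 2)⁻¹ • y) (norm_sq_smul_eq v x)
  simp only [smul_smul, inv_mul_cancel₀ h0, one_smul, smul_add] at h
  rw [dualPerp, smul_smul, mul_comm (inner ℂ v x), mul_comm (wedge v x)]
  exact h

lemma norm_inner_mul_inv_le {v : C2} (hv : v ≠ 0) (x : C2) :
    ‖(inner ℂ v x : ℂ) * ((‖v‖ : ℂ) ^ 2)⁻¹‖ ≤ ‖x‖ / ‖v‖ := by
  have h0 : 0 < ‖v‖ := norm_pos_iff.2 hv
  rw [norm_mul, norm_inv, norm_pow, Complex.norm_real, norm_norm, ← div_eq_mul_inv,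
    div_le_div_iff₀ (by positivity) h0]
  nlinarith [norm_inner_le_norm (𝕜 := ℂ) v x]

section Dynamics

variable {Ω : Type*} [MetricSpace Ω] {T : Ω ≃ₜ Ω} {A : Ω → unimodularGL2}

/-- In the moving frame formed by the orbit vector and its `dualPerp` the cocycle is upper
triangular with unimodular diagonal. Each step adds at most `K / δ ^ 2` to the off-diagonal entry,
so that entry grows only linearly. -/
lemma exists_iter_dualPerp_eq {K : ℝ} (hK : CocycleBound A K) {ω : Ω} {v : C2} (hv : v ≠ 0)
    (p : ℤ) {δ : ℝ} (hδ : 0 < δ) (m : ℕ)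
    (h : ∀ i : ℕ, i ≤ m → δ ≤ ‖matOp (cocycleIter T A (p + i) ω) v‖) :
    ∃ c d : ℂ, ‖d‖ = 1 ∧ ‖c‖ ≤ m * (K / δ ^ 2) ∧
      matOp (cocycleIter T A m ((T ^ p) ω)) (dualPerp (matOp (cocycleIter T A p ω) v)) =
        c • matOp (cocycleIter T A (p + m) ω) v +
          d • dualPerp (matOp (cocycleIter T A (p + m) ω) v) := by
  have hK0 : 0 ≤ K := zero_le_one.trans hK.1
  induction m with
  | zero => exact ⟨0, 1, by simp, by simp, by simp [matOp_one_apply]⟩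
  | succ m ih =>
    obtain ⟨c, d, hd, hc, heq⟩ := ih fun i hi => h i (by omega)
    set x := matOp (cocycleIter T A (p + m) ω) v with hx
    set M := A ((T ^ (p + (m : ℤ))) ω) with hM
    have hx0 : x ≠ 0 := matOp_ne_zero _ hv
    have hMx0 : matOp M x ≠ 0 := matOp_ne_zero _ hx0
    have hnext : matOp (cocycleIter T A (p + (m + 1 : ℕ)) ω) v = matOp M x := by
      rw [Nat.cast_succ, ← add_assoc, cocycleIter_add_one, matOp_mul_apply]
    have hstep : matOp (cocycleIter T A (m + 1 : ℕ) ((T ^ p) ω)) (dualPerp (matOp (cocycleIter T A p ω) v))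
        = matOp M (c • x + d • dualPerp x) := by
      rw [Nat.cast_succ, cocycleIter_add_one, matOp_mul_apply, heq, ← Homeomorph.zpow_add_apply,
        add_comm (m : ℤ) p]
    have hdx : δ ≤ ‖x‖ := h m (by omega)
    have hdM : δ ≤ ‖matOp M x‖ := by
      have := h (m + 1) le_rfl
      rwa [hnext] at this
    rw [hstep, hnext]
    refine ⟨c + d * ((inner ℂ (matOp M x) (matOp M (dualPerp x)) : ℂ) *
      ((‖matOp M x‖ : ℂ) ^ 2)⁻¹), d * wedge (matOp M x) (matOp M (dualPerp x)), ?_, ?_, ?_⟩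
    · rw [norm_mul, hd, norm_wedge_matOp, wedge_dualPerp hx0]; simp
    · refine (norm_add_le _ _).trans ?_
      rw [Nat.cast_succ, add_mul, one_mul]
      refine add_le_add hc ?_
      rw [norm_mul, hd, one_mul]
      refine (norm_inner_mul_inv_le hMx0 _).trans ?_
      have h1 := (hK.2 ((T ^ (p + (m : ℤ))) ω) (dualPerp x)).1
      rw [norm_dualPerp] at h1
      calc ‖matOp M (dualPerp x)‖ / ‖matOp M x‖ ≤ K * δ⁻¹ / δ := by
            gcongr
            refine h1.trans ?_
            gcongr
        _ = K / δ ^ 2 := by field_simp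
    · rw [map_add, map_smul, map_smul]
      conv_lhs => rw [eq_smul_add_smul_dualPerp hMx0 (matOp M (dualPerp x))]
      rw [smul_add, smul_smul, smul_smul, add_smul, add_assoc]

/-- The orbit must be comparable to `δ` only at the two ends; in between it only needs to stay above
`δ`. The powers of `δ` then cancel and the bound is linear in `m`. -/
lemma norm_iter_le_of_level {K : ℝ} (hK : CocycleBound A K) {ω : Ω} {v : C2} (hv : v ≠ 0)
    (p : ℤ) {δ D : ℝ} (hδ : 0 < δ) (m : ℕ)
    (h : ∀ i : ℕ, i ≤ m → δ ≤ ‖matOp (cocycleIter T A (p + i) ω) v‖)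
    (hp : ‖matOp (cocycleIter T A p ω) v‖ ≤ D * δ)
    (hm : ‖matOp (cocycleIter T A (p + m) ω) v‖ ≤ D * δ) :
    ‖matOp (cocycleIter T A m ((T ^ p) ω))‖ ≤ 2 * D + m * (K * D ^ 2) := by
  have hK0 : 0 ≤ K := zero_le_one.trans hK.1
  obtain ⟨c, d, hd, hc, heq⟩ := exists_iter_dualPerp_eq hK hv p hδ m h
  have hx0 : matOp (cocycleIter T A p ω) v ≠ 0 := matOp_ne_zero _ hv
  have hq : matOp (cocycleIter T A m ((T ^ p) ω)) (matOp (cocycleIter T A p ω) v) =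
      matOp (cocycleIter T A (p + m) ω) v := by
    rw [add_comm p, cocycleIter_add_apply]
  have hdx : δ ≤ ‖matOp (cocycleIter T A p ω) v‖ := by simpa using h 0 (Nat.zero_le _)
  have hdy : δ ≤ ‖matOp (cocycleIter T A (p + m) ω) v‖ := h m le_rfl
  set x := matOp (cocycleIter T A p ω) v
  set y := matOp (cocycleIter T A (p + m) ω) v
  have hD0 : 0 ≤ D := by
    by_contra! hD
    nlinarith
  refine ContinuousLinearMap.opNorm_le_bound _ (by positivity) fun w => ?_
  rw [eq_smul_add_smul_dualPerp hx0 w, map_add, map_smul, map_smul, hq, heq,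
    ← eq_smul_add_smul_dualPerp hx0 w]
  have hw1 := norm_inner_mul_inv_le hx0 w
  have hw2 := norm_wedge_le x w
  calc _ ≤ ‖w‖ / ‖x‖ * ‖y‖ + ‖x‖ * ‖w‖ * (‖c‖ * ‖y‖ + 1 * ‖y‖⁻¹) := by
        refine (norm_add_le _ _).trans (add_le_add ?_ ?_)
        · rw [norm_smul]
          gcongr
        · rw [norm_smul]
          gcongr
          refine (norm_add_le _ _).trans_eq ?_
          rw [norm_smul, norm_smul, hd, norm_dualPerp]
    _ ≤ ‖w‖ / δ * (D * δ) + (D * δ) * ‖w‖ * (m * (K / δ ^ 2) * (D * δ) + 1 * δ⁻¹) := by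
        gcongr
    _ = (2 * D + m * (K * D ^ 2)) * ‖w‖ := by
        field_simp
        ring

/-- Take the first `q` at which `a` drops below `K⁻ᴹ`. One step loses at most a factor `K`, so this
needs at least `M` steps and cannot overshoot below `K⁻ᴹ / K`. -/
lemma exists_first_hit {a : ℕ → ℝ} {K : ℝ} (hK : 1 ≤ K) (ha : ∀ n, a n ≤ K * a (n + 1))
    (h0 : 1 ≤ a 0) (hinf : ∀ δ > 0, ∃ n, a n < δ) (M : ℕ) :
    ∃ q, M ≤ q ∧ a q ≤ K * ((K ^ M)⁻¹ / K) ∧ ∀ i ≤ q, (K ^ M)⁻¹ / K ≤ a i := by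
  have hK0 : 0 < K := by linarith
  have hμ : 0 < (K ^ M)⁻¹ := by positivity
  have hex := hinf _ hμ
  classical
  have hq := Nat.find_spec hex
  have hmin : ∀ i < Nat.find hex, (K ^ M)⁻¹ ≤ a i := fun i hi => not_lt.1 (Nat.find_min hex hi)
  set q := Nat.find hex
  have hpow : ∀ n, 1 ≤ K ^ n * a n := fun n => by
    induction n with
    | zero => simpa using h0
    | succ n ih =>
      rw [pow_succ, mul_assoc]
      exact ih.trans (mul_le_mul_of_nonneg_left (ha n) (by positivity))
  refine ⟨q, ?_, ?_, ?_⟩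
  · by_contra! hlt
    have h1 := hpow q
    have h2 : K ^ q ≤ K ^ M := pow_le_pow_right₀ hK hlt.le
    have h3 : K ^ q * a q < K ^ M * (K ^ M)⁻¹ := by
      calc K ^ q * a q < K ^ q * (K ^ M)⁻¹ := by gcongr
        _ ≤ _ := by gcongr
    rw [mul_inv_cancel₀ (by positivity)] at h3
    linarith
  · rw [mul_div_cancel₀ _ hK0.ne']
    exact hq.le
  · intro i hi
    rcases hi.lt_or_eq with h | h
    · exact (div_le_self hμ.le hK).trans (hmin i h)
    · rcases Nat.eq_zero_or_pos q with hq0 | hq0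
      · rw [h, hq0]
        refine le_trans ?_ h0
        exact (div_le_self hμ.le hK).trans (inv_le_one_of_one_le₀ (one_le_pow₀ hK))
      · have h1 := hmin (q - 1) (by omega)
        have h2 := ha (q - 1)
        rw [Nat.sub_add_cancel hq0] at h2
        rw [h, div_le_iff₀ hK0, mul_comm]
        exact h1.trans h2

/-- Either the orbit is bounded below on a half-line, which supplies windows of any length, or it
becomes arbitrarily small in both directions and the window runs between the first passages below a
common level. -/
lemma exists_long_level {K : ℝ} (hK : CocycleBound A K) {ω : Ω} {v : C2} (hv : ‖v‖ = 1)
    (hle : ∀ n : ℤ, ‖matOp (cocycleIter T A n ω) v‖ ≤ 1) :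
    ∃ D : ℝ, ∀ M : ℕ, ∃ (p : ℤ) (m : ℕ) (δ : ℝ), M ≤ m ∧ 0 < δ ∧
      (∀ i : ℕ, i ≤ m → δ ≤ ‖matOp (cocycleIter T A (p + i) ω) v‖) ∧
      ‖matOp (cocycleIter T A p ω) v‖ ≤ D * δ ∧
      ‖matOp (cocycleIter T A (p + m) ω) v‖ ≤ D * δ := by
  by_cases h1 : ∃ δ > 0, ∀ n : ℕ, δ ≤ ‖matOp (cocycleIter T A n ω) v‖
  · obtain ⟨δ, hδ, h⟩ := h1
    refine ⟨δ⁻¹, fun M => ⟨0, M, δ, le_rfl, hδ, fun i _ => ?_, ?_, ?_⟩⟩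
    · rw [zero_add]; exact h i
    · rw [inv_mul_cancel₀ hδ.ne']; exact hle _
    · rw [inv_mul_cancel₀ hδ.ne']; exact hle _
  by_cases h2 : ∃ δ > 0, ∀ n : ℕ, δ ≤ ‖matOp (cocycleIter T A (-n) ω) v‖
  · obtain ⟨δ, hδ, h⟩ := h2
    refine ⟨δ⁻¹, fun M => ⟨-M, M, δ, le_rfl, hδ, fun i hi => ?_, ?_, ?_⟩⟩
    · have := h (M - i)
      rwa [Nat.cast_sub hi, neg_sub, sub_eq_neg_add] at this
    · rw [inv_mul_cancel₀ hδ.ne']; exact hle _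
    · rw [inv_mul_cancel₀ hδ.ne']; exact hle _
  push Not at h1 h2
  have hK0 : 0 < K := zero_lt_one.trans_le hK.1
  have hnb : ∀ m n : ℤ, (m - n).natAbs ≤ 1 →
      ‖matOp (cocycleIter T A m ω) v‖ ≤ K * ‖matOp (cocycleIter T A n ω) v‖ := fun m n hmn => by
    have := hK.norm_iter_le_of_le (T := T) hmn ((T ^ n) ω) (matOp (cocycleIter T A n ω) v)
    rwa [← cocycleIter_add_apply, sub_add_cancel, pow_one] at this
  refine ⟨K, fun M => ?_⟩
  obtain ⟨q, hMq, hq, hqi⟩ := exists_first_hit (a := fun n : ℕ =>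
    ‖matOp (cocycleIter T A n ω) v‖) hK.1 (fun n => hnb _ _ (by omega))
    (by simp [matOp_one_apply, hv]) h1 M
  obtain ⟨r, hMr, hr, hri⟩ := exists_first_hit (a := fun n : ℕ =>
    ‖matOp (cocycleIter T A (-n) ω) v‖) hK.1 (fun n => hnb _ _ (by omega))
    (by simp [matOp_one_apply, hv]) h2 M
  refine ⟨-r, r + q, (K ^ M)⁻¹ / K, by omega, by positivity, fun i hi => ?_, hr, ?_⟩
  · rcases le_total i r with hir | hir
    · have := hri (r - i) (by omega)
      simp only [Nat.cast_sub hir, neg_sub] at this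
      rwa [sub_eq_neg_add] at this
    · have := hqi (i - r) (by omega)
      simp only [Nat.cast_sub hir] at this
      rwa [sub_eq_neg_add] at this
  · rw [Nat.cast_add, neg_add_cancel_left]
    exact hq

theorem not_hasSackerSell_of_uniformExpGrowth [CompactSpace Ω] (hA : Continuous A)
    (h : UniformExpGrowth T A) : ¬ HasSackerSell T A := by
  rintro ⟨ω, v, hv, hle⟩
  obtain ⟨K, hK⟩ := exists_cocycleBound hA
  obtain ⟨C, l, hC, hl, hgrow⟩ := h
  obtain ⟨D, hD⟩ := exists_long_level hK hv hle
  have hv0 : v ≠ 0 := by rintro rfl; simp at hv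
  have hlim : Filter.Tendsto (fun m : ℕ => 2 * D * ((m : ℝ) ^ 0 / l ^ m) +
      K * D ^ 2 * ((m : ℝ) ^ 1 / l ^ m)) Filter.atTop (nhds (2 * D * 0 + K * D ^ 2 * 0)) :=
    ((tendsto_pow_const_div_const_pow_of_one_lt 0 hl).const_mul _).add
      ((tendsto_pow_const_div_const_pow_of_one_lt 1 hl).const_mul _)
  rw [mul_zero, mul_zero, add_zero] at hlim
  obtain ⟨M, hM⟩ := Filter.eventually_atTop.1 (hlim.eventually (gt_mem_nhds hC))
  obtain ⟨p, m, δ, hMm, hδ, h1, h2, h3⟩ := hD M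
  have h4 := norm_iter_le_of_level hK hv0 p hδ m h1 h2 h3
  have h5 := hgrow m ((T ^ p) ω)
  have h6 := hM m hMm
  rw [Int.natAbs_natCast] at h5
  have hlm : 0 < l ^ m := pow_pos (by linarith) m
  have h7 : 2 * D * ((m : ℝ) ^ 0 / l ^ m) + K * D ^ 2 * ((m : ℝ) ^ 1 / l ^ m) =
      (2 * D + m * (K * D ^ 2)) / l ^ m := by
    field_simp
  rw [h7, div_lt_iff₀ hlm] at h6
  linarith

end Dynamics

/-! ### The inhomogeneous recursion in the absence of bounded orbits -/

section Dynamics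

variable {Ω : Type*} [MetricSpace Ω] {T : Ω ≃ₜ Ω} {A : Ω → unimodularGL2}

/-- Discrete variation of constants: each of the `|k|` defects is transported by at most `K ^ |k|`.
-/
lemma norm_sub_iter_le {K : ℝ} (hK : CocycleBound A K) (ω : Ω) (V : ℤ → C2) (n : ℤ) {N : ℕ}
    {Y : ℝ} (hY : ∀ j : ℤ, (j - n).natAbs ≤ N → ‖V (j + 1) - matOp (A ((T ^ j) ω)) (V j)‖ ≤ Y)
    (k : ℤ) (hk : k.natAbs ≤ N) :
    ‖V (n + k) - matOp (cocycleIter T A k ((T ^ n) ω)) (V n)‖ ≤ k.natAbs * K ^ k.natAbs * Y := by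
  have hK0 : 0 < K := zero_lt_one.trans_le hK.1
  have hY0 : 0 ≤ Y := (norm_nonneg _).trans (hY n (by simp))
  have hstep : ∀ i : ℕ, K * (i * K ^ i * Y + Y) ≤ ((i + 1 : ℕ) : ℝ) * K ^ (i + 1) * Y := fun i => by
    have h1 : (1 : ℝ) ≤ K ^ i := one_le_pow₀ hK.1
    have h2 : Y * 1 ≤ Y * K ^ i := mul_le_mul_of_nonneg_left h1 hY0
    calc K * (i * K ^ i * Y + Y) ≤ K * (i * K ^ i * Y + Y * K ^ i) := by gcongr; linarith
      _ = _ := by push_cast; ring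
  induction k with
  | zero => simp [matOp_one_apply]
  | succ i ih =>
    have hi : ((i : ℤ) + 1).natAbs = i + 1 := by omega
    have h1 := ih (by omega)
    have h2 := hY (n + i) (by omega)
    have h3 := (hK.2 ((T ^ (n + (i : ℤ))) ω)
      (V (n + i) - matOp (cocycleIter T A i ((T ^ n) ω)) (V n))).1
    rw [Int.natAbs_natCast] at h1
    have heq : V (n + (i + 1)) - matOp (cocycleIter T A (i + 1) ((T ^ n) ω)) (V n) =
        (V (n + i + 1) - matOp (A ((T ^ (n + (i : ℤ))) ω)) (V (n + i))) +
          matOp (A ((T ^ (n + (i : ℤ))) ω))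
            (V (n + i) - matOp (cocycleIter T A i ((T ^ n) ω)) (V n)) := by
      rw [cocycleIter_add_one, matOp_mul_apply, ← Homeomorph.zpow_add_apply, add_comm (i : ℤ) n,
        map_sub, add_assoc n]
      abel
    rw [heq, hi]
    refine (norm_add_le _ _).trans ((add_le_add h2 (h3.trans
      (mul_le_mul_of_nonneg_left h1 hK0.le))).trans (le_trans ?_ (hstep i)))
    nlinarith [hK.1]
  | pred i ih =>
    have hi : (-(i : ℤ) - 1).natAbs = i + 1 := by omega
    have h1 := ih (by omega)
    have h2 := hY (n + (-i - 1)) (by omega)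
    rw [Int.natAbs_neg, Int.natAbs_natCast] at h1
    have heq : V (n + (-i - 1)) - matOp (cocycleIter T A (-i - 1) ((T ^ n) ω)) (V n) =
        matOp (A ((T ^ (n + (-(i : ℤ) - 1))) ω))⁻¹
          ((V (n + -i) - matOp (cocycleIter T A (-i) ((T ^ n) ω)) (V n)) -
          (V (n + (-i - 1) + 1) - matOp (A ((T ^ (n + (-(i : ℤ) - 1))) ω)) (V (n + (-i - 1))))) := by
      rw [cocycleIter_sub_one, matOp_mul_apply, ← Homeomorph.zpow_add_apply,
        add_comm (-(i : ℤ) - 1) n, show n + (-(i : ℤ) - 1) + 1 = n + -i by ring, map_sub, map_sub,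
        map_sub, matOp_inv_apply_self]
      abel
    rw [heq, hi]
    refine ((hK.2 _ _).2).trans ((mul_le_mul_of_nonneg_left ((norm_sub_le _ _).trans
      (add_le_add h1 h2)) hK0.le).trans (hstep i))

/-- The bound at one site in terms of an exponentially weighted supremum of the defects. -/
lemma norm_le_of_weighted_defect {K : ℝ} (hK : CocycleBound A K) {N : ℕ}
    (hN : DoublesWithin T A N) {θ : ℝ} (hθ0 : 0 < θ) (hθ1 : θ ≤ 1) (hθN : 3 / 4 ≤ θ ^ N) (ω : Ω)
    (V : ℤ → C2) {B : ℝ} (hB : ∀ n, ‖V n‖ ≤ B) (m : ℤ) {Y : ℝ}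
    (hY : ∀ j : ℤ, θ ^ (j - m).natAbs * ‖V (j + 1) - matOp (A ((T ^ j) ω)) (V j)‖ ≤ Y) :
    ‖V m‖ ≤ 2 * (N * K ^ N) * Y := by
  have hK0 : 0 < K := zero_lt_one.trans_le hK.1
  set X : ℝ := ⨆ n : ℤ, θ ^ (n - m).natAbs * ‖V n‖ with hX
  have hbdd : BddAbove (Set.range fun n : ℤ => θ ^ (n - m).natAbs * ‖V n‖) := by
    refine ⟨B, ?_⟩
    rintro _ ⟨n, rfl⟩
    exact (mul_le_of_le_one_left (norm_nonneg _) (pow_le_one₀ hθ0.le hθ1)).trans (hB n)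
  have hY0 : 0 ≤ Y := le_trans (by positivity) (hY 0)
  have hX0 : 0 ≤ X := le_trans (by positivity) (le_ciSup hbdd 0)
  have hw : ∀ n j : ℤ, (j - n).natAbs ≤ N →
      θ ^ (n - m).natAbs ≤ 4 / 3 * θ ^ (j - m).natAbs := fun n j hnj => by
    have h1 : θ ^ N * θ ^ (n - m).natAbs ≤ θ ^ (j - m).natAbs := by
      rw [← pow_add]
      exact pow_le_pow_of_le_one hθ0.le hθ1 (by omega)
    have h2 : 3 / 4 * θ ^ (n - m).natAbs ≤ θ ^ N * θ ^ (n - m).natAbs := by gcongr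
    linarith
  -- Doubling gives `2 * ‖V n‖ ≤ ‖V (n + k)‖ + error`. The weights change by at most a factor 4/3
  -- over distance `N`, so the `X` on the right has coefficient 2/3 and can be absorbed. The bound
  -- `B` serves only to make `X` finite.
  have hmain : X ≤ 2 / 3 * (X + N * K ^ N * Y) := by
    refine ciSup_le fun n => ?_
    obtain ⟨k, hk, h2⟩ := hN ((T ^ n) ω) (V n)
    have hpos : 0 < θ ^ (n - m).natAbs := pow_pos hθ0 _
    have h3 := norm_sub_iter_le hK ω V n (N := N)
      (Y := 4 / 3 * Y / θ ^ (n - m).natAbs) (fun j hj => by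
        rw [le_div_iff₀ hpos, mul_comm]
        calc _ ≤ 4 / 3 * θ ^ (j - m).natAbs * ‖V (j + 1) - matOp (A ((T ^ j) ω)) (V j)‖ := by
              gcongr; exact hw n j hj
          _ ≤ _ := by rw [mul_assoc]; gcongr; exact hY j) k hk
    have h4 : ‖matOp (cocycleIter T A k ((T ^ n) ω)) (V n)‖ ≤ ‖V (n + k)‖ +
        N * K ^ N * (4 / 3 * Y / θ ^ (n - m).natAbs) := by
      have h5 := norm_sub_norm_le (matOp (cocycleIter T A k ((T ^ n) ω)) (V n)) (V (n + k))
      rw [norm_sub_rev] at h5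
      have h6 : (k.natAbs : ℝ) * K ^ k.natAbs * (4 / 3 * Y / θ ^ (n - m).natAbs) ≤
          N * K ^ N * (4 / 3 * Y / θ ^ (n - m).natAbs) := by
        gcongr
        exact hK.1
      linarith
    have h7 : θ ^ (n - m).natAbs * ‖V (n + k)‖ ≤ 4 / 3 * X := by
      calc _ ≤ 4 / 3 * θ ^ (n + k - m).natAbs * ‖V (n + k)‖ := by
            gcongr; exact hw n (n + k) (by simpa using hk)
        _ ≤ _ := by rw [mul_assoc]; gcongr; exact le_ciSup hbdd (n + k)
    have h8 : θ ^ (n - m).natAbs * (2 * ‖V n‖) ≤ θ ^ (n - m).natAbs * (‖V (n + k)‖ +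
        N * K ^ N * (4 / 3 * Y / θ ^ (n - m).natAbs)) := by
      gcongr; linarith
    have h9 : θ ^ (n - m).natAbs * (N * K ^ N * (4 / 3 * Y / θ ^ (n - m).natAbs)) =
        4 / 3 * (N * K ^ N * Y) := by field_simp
    rw [mul_add, h9] at h8
    linarith
  have hm : ‖V m‖ ≤ X := by
    have := le_ciSup hbdd m
    simpa using this
  linarith

lemma summable_pow_natAbs {θ : ℝ} (h0 : 0 ≤ θ) (h1 : θ < 1) :
    Summable fun n : ℤ => θ ^ n.natAbs := by
  refine Summable.of_nat_of_neg ?_ ?_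
  · simpa using summable_geometric_of_lt_one h0 h1
  · simpa using summable_geometric_of_lt_one h0 h1

/-- Young's inequality for convolution with an exponential weight: exchange the sums and sum the
weight over `m`. -/
lemma sum_tsum_pow_natAbs_mul_le {θ : ℝ} (h0 : 0 ≤ θ) (h1 : θ < 1) {g : ℤ → ℝ}
    (hg : ∀ j, 0 ≤ g j) (hs : Summable g) (s : Finset ℤ) :
    ∑ m ∈ s, ∑' j : ℤ, θ ^ (j - m).natAbs * g j ≤ (∑' n : ℤ, θ ^ n.natAbs) * ∑' j, g j := by
  have hsum : ∀ m : ℤ, Summable fun j : ℤ => θ ^ (j - m).natAbs * g j := fun m =>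
    hs.of_nonneg_of_le (fun j => mul_nonneg (pow_nonneg h0 _) (hg j))
      (fun j => mul_le_of_le_one_left (hg j) (pow_le_one₀ h0 h1.le))
  have hθ := summable_pow_natAbs h0 h1
  rw [← Summable.tsum_finsetSum fun m _ => hsum m, ← tsum_mul_left]
  refine Summable.tsum_le_tsum (fun j => ?_) (summable_sum fun m _ => hsum m) (hs.mul_left _)
  rw [← Finset.sum_mul]
  refine mul_le_mul_of_nonneg_right ?_ (hg j)
  have h3 := ((Equiv.subLeft j).summable_iff (f := fun n : ℤ => θ ^ n.natAbs)).2 hθ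
  have h4 := (Equiv.subLeft j).tsum_eq (fun n : ℤ => θ ^ n.natAbs)
  simp only [Function.comp_def, Equiv.subLeft_apply] at h3 h4
  rw [← h4]
  exact h3.sum_le_tsum s fun _ _ => pow_nonneg h0 _

/-- Bounded sequences are controlled in `ℓ²` by their defects, if no orbit is bounded. -/
lemma exists_sum_norm_sq_le [CompactSpace Ω] (hA : Continuous A) (h : ¬ HasSackerSell T A) :
    ∃ C : ℝ, 0 ≤ C ∧ ∀ (ω : Ω) (V : ℤ → C2) (B : ℝ), (∀ n, ‖V n‖ ≤ B) →
      (Summable fun j : ℤ => ‖V (j + 1) - matOp (A ((T ^ j) ω)) (V j)‖ ^ 2) →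
      ∀ s : Finset ℤ, ∑ m ∈ s, ‖V m‖ ^ 2 ≤
        C * ∑' j : ℤ, ‖V (j + 1) - matOp (A ((T ^ j) ω)) (V j)‖ ^ 2 := by
  obtain ⟨K, hK⟩ := exists_cocycleBound hA
  obtain ⟨N, hN0, hN⟩ := exists_doublesWithin hA h
  have hNR : (0 : ℝ) < N := by exact_mod_cast hN0
  obtain ⟨θ, hθ0, hθ1, hθN⟩ : ∃ θ : ℝ, 0 < θ ∧ θ < 1 ∧ θ ^ N = 3 / 4 :=
    ⟨(3 / 4 : ℝ) ^ ((N : ℝ)⁻¹), by positivity,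
      Real.rpow_lt_one (by norm_num) (by norm_num) (by positivity),
      Real.rpow_inv_natCast_pow (by norm_num) hN0.ne'⟩
  have hK0 : 0 < K := zero_lt_one.trans_le hK.1
  refine ⟨(2 * (N * K ^ N)) ^ 2 * ∑' n : ℤ, (θ ^ 2) ^ n.natAbs,
    mul_nonneg (by positivity) (tsum_nonneg fun _ => by positivity), fun ω V B hB hs s => ?_⟩
  set H : ℤ → ℝ := fun j => ‖V (j + 1) - matOp (A ((T ^ j) ω)) (V j)‖ with hH
  have hwle : ∀ k : ℕ, (θ ^ 2) ^ k ≤ 1 := fun k => pow_le_one₀ (by positivity) (by nlinarith)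
  have hsum : ∀ m : ℤ, Summable fun j : ℤ => (θ ^ 2) ^ (j - m).natAbs * H j ^ 2 := fun m =>
    hs.of_nonneg_of_le (fun j => by positivity)
      (fun j => mul_le_of_le_one_left (by positivity) (hwle _))
  have hm : ∀ m : ℤ, ‖V m‖ ^ 2 ≤
      (2 * (N * K ^ N)) ^ 2 * ∑' j : ℤ, (θ ^ 2) ^ (j - m).natAbs * H j ^ 2 := fun m => by
    -- One weighted defect is at most the root of the sum of all their squares, so that root serves
    -- as `Y`, and squaring turns `θ` into `θ ^ 2`.
    have h1 := norm_le_of_weighted_defect hK hN hθ0 hθ1.le hθN.ge ω V hB m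
      (Y := Real.sqrt (∑' j : ℤ, (θ ^ 2) ^ (j - m).natAbs * H j ^ 2)) (fun j => by
        refine Real.le_sqrt_of_sq_le ?_
        refine le_trans (le_of_eq ?_) ((hsum m).le_tsum j fun i _ => by positivity)
        rw [mul_pow, ← pow_mul, ← pow_mul, mul_comm _ 2])
    have h2 : 0 ≤ ∑' j : ℤ, (θ ^ 2) ^ (j - m).natAbs * H j ^ 2 :=
      tsum_nonneg fun j => by positivity
    calc ‖V m‖ ^ 2 ≤ (2 * (N * K ^ N) *
          Real.sqrt (∑' j : ℤ, (θ ^ 2) ^ (j - m).natAbs * H j ^ 2)) ^ 2 := by gcongr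
      _ = _ := by rw [mul_pow, Real.sq_sqrt h2]
  calc ∑ m ∈ s, ‖V m‖ ^ 2
      ≤ ∑ m ∈ s, (2 * (N * K ^ N)) ^ 2 * ∑' j : ℤ, (θ ^ 2) ^ (j - m).natAbs * H j ^ 2 :=
        Finset.sum_le_sum fun m _ => hm m
    _ = (2 * (N * K ^ N)) ^ 2 * ∑ m ∈ s, ∑' j : ℤ, (θ ^ 2) ^ (j - m).natAbs * H j ^ 2 :=
        (Finset.mul_sum _ _ _).symm
    _ ≤ (2 * (N * K ^ N)) ^ 2 * ((∑' n : ℤ, (θ ^ 2) ^ n.natAbs) * ∑' j : ℤ, H j ^ 2) :=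
        mul_le_mul_of_nonneg_left (sum_tsum_pow_natAbs_mul_le (by positivity) (by nlinarith)
          (fun j => sq_nonneg (H j)) hs s) (by positivity)
    _ = _ := (mul_assoc _ _ _).symm

end Dynamics

/-! ### Factorization of extended CMV matrices -/

lemma ofReal_cmvRho_sq (α : 𝔻) : (cmvRho α : ℂ) ^ 2 = 1 - (α : ℂ) * conj (α : ℂ) := by
  rw [Complex.mul_conj, Complex.normSq_eq_norm_sq]
  exact_mod_cast cmvRho_sq α

lemma ofReal_cmvRho_ne_zero (α : 𝔻) : (cmvRho α : ℂ) ≠ 0 := by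
  exact_mod_cast (cmvRho_pos α).ne'

lemma cmvRho_star (α : 𝔻) : cmvRho (star α) = cmvRho α := by
  simp [cmvRho]

/-- The block-diagonal factor of the extended CMV matrix whose blocks sit at the sites `n`, `n + 1`
with `n + e` even, acting on arbitrary sequences. -/
def cmvFactorSeq (e : ℤ) (α : ℤ → 𝔻) (u : ℤ → ℂ) (n : ℤ) : ℂ :=
  if Even (n + e) then conj (α n : ℂ) * u n + (cmvRho (α n) : ℂ) * u (n + 1)
  else (cmvRho (α (n - 1)) : ℂ) * u (n - 1) - (α (n - 1) : ℂ) * u n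

lemma cmvFactorSeq_of_even {e n : ℤ} (h : Even (n + e)) (α : ℤ → 𝔻) (u : ℤ → ℂ) :
    cmvFactorSeq e α u n = conj (α n : ℂ) * u n + (cmvRho (α n) : ℂ) * u (n + 1) := if_pos h

lemma cmvFactorSeq_add_one_of_even {e n : ℤ} (h : Even (n + e)) (α : ℤ → 𝔻) (u : ℤ → ℂ) :
    cmvFactorSeq e α u (n + 1) = (cmvRho (α n) : ℂ) * u n - (α n : ℂ) * u (n + 1) := by
  have h' : ¬ Even (n + 1 + e) := by
    rw [add_right_comm, Int.even_add_one, not_not]; exact h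
  rw [cmvFactorSeq, if_neg h', add_sub_cancel_right]

lemma even_or_exists_add_one (e n : ℤ) : Even (n + e) ∨ ∃ m, n = m + 1 ∧ Even (m + e) := by
  by_cases h : Even (n + e)
  · exact Or.inl h
  · refine Or.inr ⟨n - 1, by ring, ?_⟩
    rw [Int.not_even_iff_odd] at h
    obtain ⟨k, hk⟩ := h
    exact ⟨k, by omega⟩

/-- Each block is a symmetric unitary 2 by 2 matrix, so conjugating the coefficients gives its
inverse. -/
lemma cmvFactorSeq_star_cmvFactorSeq (e : ℤ) (α : ℤ → 𝔻) (u : ℤ → ℂ) (n : ℤ) :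
    cmvFactorSeq e (fun k => star (α k)) (cmvFactorSeq e α u) n = u n := by
  rcases even_or_exists_add_one e n with h | ⟨m, rfl, h⟩
  · rw [cmvFactorSeq_of_even h, cmvFactorSeq_of_even h, cmvFactorSeq_add_one_of_even h, cmvRho_star]
    simp only [Complex.UnitDisc.coe_star, Complex.conj_conj]
    linear_combination u n * ofReal_cmvRho_sq (α n)
  · rw [cmvFactorSeq_add_one_of_even h, cmvFactorSeq_of_even h, cmvFactorSeq_add_one_of_even h,
      cmvRho_star]
    simp only [Complex.UnitDisc.coe_star]
    linear_combination u (m + 1) * ofReal_cmvRho_sq (α m)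

/-- The extended CMV matrix acting on arbitrary sequences. -/
def cmvSeq (α : ℤ → 𝔻) (u : ℤ → ℂ) (n : ℤ) : ℂ :=
  ∑ k ∈ Finset.Icc (-2 : ℤ) 2, cmvEntry α n (n + k) * u (n + k)

lemma Icc_neg_two_two : Finset.Icc (-2 : ℤ) 2 = {-2, -1, 0, 1, 2} := by decide

/-- The factorization of the CMV matrix: the left factor has its blocks at even sites, the right one
at odd sites. -/
lemma cmvSeq_eq (α : ℤ → 𝔻) (u : ℤ → ℂ) (n : ℤ) :
    cmvSeq α u n = cmvFactorSeq 0 α (cmvFactorSeq 1 α u) n := by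
  have h1 : ∀ i : ℤ, i + -2 = i - 2 := fun _ => rfl
  have h2 : ∀ i : ℤ, i + -1 = i - 1 := fun _ => rfl
  rcases even_or_exists_add_one 0 n with h | ⟨m, rfl, h⟩
  · have hm : Even (n - 1 + 1) := by simpa using h
    have hp : Even (n + 1 + 1) := by
      rw [add_zero] at h
      rw [add_assoc]
      exact h.add (by decide)
    rw [cmvFactorSeq_of_even h, cmvFactorSeq_of_even hp]
    have h3 := cmvFactorSeq_add_one_of_even hm α u
    rw [sub_add_cancel] at h3
    rw [h3]
    have hn : Even n := by simpa using h
    have e1 : ¬ (n - 2 = n - 1) := by omega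
    have e5 : ¬ (n = n - 1) := by omega
    have e6 : ¬ (n + 1 = n - 1) := by omega
    have e7 : ¬ (n + 2 = n - 1) := by omega
    simp [cmvSeq, Icc_neg_two_two, cmvEntry, hn, h1, h2, e1, e5, e6, e7]
    rw [show n + 1 + 1 = n + 2 by ring]
    ring
  · have hm : Even (m - 1 + 1) := by simpa using h
    have hp : Even (m + 1 + 1) := by
      rw [add_zero] at h
      rw [add_assoc]
      exact h.add (by decide)
    rw [cmvFactorSeq_add_one_of_even h, cmvFactorSeq_of_even hp]
    have h3 := cmvFactorSeq_add_one_of_even hm α u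
    rw [sub_add_cancel] at h3
    rw [h3]
    have hn : ¬ Even (m + 1) := by
      rw [Int.even_add_one, not_not]; simpa using h
    have e0 : m + 1 - 2 = m - 1 := by ring
    have e1 : ¬ (m = m - 1) := by omega
    have e2 : ¬ (m + 1 = m - 1) := by omega
    have e3 : ¬ (m + 1 + 1 = m - 1) := by omega
    have e4 : ¬ (m + 1 + 1 = m) := by omega
    have e5 : ¬ (m + 1 + 2 = m - 1) := by omega
    have e6 : ¬ (m + 1 + 2 = m) := by omega
    simp [cmvSeq, Icc_neg_two_two, cmvEntry, hn, h1, h2, e0, e1, e2, e3, e4, e5, e6]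
    ring

/-! ### Unitarity -/

lemma ellTwo_hasSum_norm_sq (u : ellTwo) : HasSum (fun n => ‖u n‖ ^ 2) (‖u‖ ^ 2) := by
  have := lp.hasSum_norm (p := 2) (by simp) u
  simpa using this

lemma weightedShift_sum_le (k : ℤ) (b : ℤ → ℂ) (hb : ∀ n, ‖b n‖ ≤ 1) (u : ellTwo)
    (s : Finset ℤ) :
    ∑ n ∈ s, ‖b n * u (n + k)‖ ^ (2 : ENNReal).toReal ≤ ‖u‖ ^ (2 : ENNReal).toReal := by
  calc ∑ n ∈ s, ‖b n * u (n + k)‖ ^ (2 : ENNReal).toReal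
      ≤ ∑ n ∈ s, ‖u (n + k)‖ ^ (2 : ENNReal).toReal := by
        refine Finset.sum_le_sum fun n _ => Real.rpow_le_rpow (norm_nonneg _) ?_ (by simp)
        rw [norm_mul]
        exact mul_le_of_le_one_left (norm_nonneg _) (hb n)
    _ = ∑ m ∈ s.map (Equiv.addRight k).toEmbedding, ‖u m‖ ^ (2 : ENNReal).toReal := by
        simp [Finset.sum_map]
    _ ≤ ‖u‖ ^ (2 : ENNReal).toReal := lp.sum_rpow_le_norm_rpow (by simp) u _

/-- The operator `u ↦ (n ↦ b n * u (n + k))` on `ℓ²(ℤ)`. -/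
def weightedShift (k : ℤ) (b : ℤ → ℂ) (hb : ∀ n, ‖b n‖ ≤ 1) : ellTwo →L[ℂ] ellTwo :=
  LinearMap.mkContinuous
    { toFun := fun u => ⟨fun n => b n * u (n + k), memℓp_gen' (weightedShift_sum_le k b hb u)⟩
      map_add' := fun u v => by
        ext n
        exact mul_add _ _ _
      map_smul' := fun c u => by
        ext n
        exact mul_left_comm _ _ _ }
    1
    (fun u => by
      rw [one_mul]
      exact lp.norm_le_of_forall_sum_le (by simp) (norm_nonneg u) (weightedShift_sum_le k b hb u))

lemma weightedShift_apply (k : ℤ) (b : ℤ → ℂ) (hb : ∀ n, ‖b n‖ ≤ 1) (u : ellTwo) (n : ℤ) :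
    weightedShift k b hb u n = b n * u (n + k) := rfl

lemma star_weightedShift (k : ℤ) (b b' : ℤ → ℂ) (hb : ∀ n, ‖b n‖ ≤ 1) (hb' : ∀ n, ‖b' n‖ ≤ 1)
    (h : ∀ n, b' (n + k) = conj (b n)) :
    star (weightedShift k b hb) = weightedShift (-k) b' hb' := by
  rw [ContinuousLinearMap.star_eq_adjoint, eq_comm, ContinuousLinearMap.eq_adjoint_iff]
  intro u v
  rw [lp.inner_eq_tsum, lp.inner_eq_tsum, ← (Equiv.addRight k).tsum_eq]
  refine tsum_congr fun n => ?_
  simp only [Equiv.coe_addRight, weightedShift_apply, h, add_neg_cancel_right, RCLike.inner_apply,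
    map_mul, Complex.conj_conj]
  ring

lemma norm_ite_coeff_le (e : ℤ) (α : ℤ → 𝔻) (n : ℤ) :
    ‖(if Even (n + e) then conj (α n : ℂ) else -(α (n - 1) : ℂ))‖ ≤ 1 := by
  split_ifs
  · rw [RCLike.norm_conj]; exact (α n).norm_lt_one.le
  · rw [norm_neg]; exact (α (n - 1)).norm_lt_one.le

lemma norm_ite_rho_le (e : ℤ) (α : ℤ → 𝔻) (n : ℤ) :
    ‖(if Even (n + e) then (cmvRho (α n) : ℂ) else 0)‖ ≤ 1 := by
  split_ifs
  · exact norm_cmvRho_le _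
  · simp

lemma norm_ite_rho_sub_one_le (e : ℤ) (α : ℤ → 𝔻) (n : ℤ) :
    ‖(if Even (n + e) then 0 else (cmvRho (α (n - 1)) : ℂ))‖ ≤ 1 := by
  split_ifs
  · simp
  · exact norm_cmvRho_le _

/-- The block-diagonal factor `cmvFactorSeq` as a bounded operator on `ℓ²(ℤ)`. -/
def cmvFactor (e : ℤ) (α : ℤ → 𝔻) : ellTwo →L[ℂ] ellTwo :=
  weightedShift 0 _ (norm_ite_coeff_le e α) + weightedShift 1 _ (norm_ite_rho_le e α) +
    weightedShift (-1) _ (norm_ite_rho_sub_one_le e α)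

lemma cmvFactor_apply (e : ℤ) (α : ℤ → 𝔻) (u : ellTwo) (n : ℤ) :
    cmvFactor e α u n = cmvFactorSeq e α u n := by
  change _ * u (n + 0) + _ * u (n + 1) + _ * u (n + -1) = _
  rw [cmvFactorSeq, add_zero, ← sub_eq_add_neg]
  by_cases h : Even (n + e)
  · simp only [if_pos h]
    ring
  · simp only [if_neg h]
    ring

lemma star_cmvFactor (e : ℤ) (α : ℤ → 𝔻) :
    star (cmvFactor e α) = cmvFactor e fun n => star (α n) := by
  have hpar : ∀ n : ℤ, Even (n + 1 + e) ↔ ¬ Even (n + e) := fun n => by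
    rw [add_right_comm, Int.even_add_one]
  have hpar' : ∀ n : ℤ, Even (n - 1 + e) ↔ ¬ Even (n + e) := fun n => by
    have := hpar (n - 1)
    rw [sub_add_cancel] at this
    rw [this, not_not]
  rw [cmvFactor, star_add, star_add,
    star_weightedShift 0 _ _ (norm_ite_coeff_le e α)
      (norm_ite_coeff_le e fun n => star (α n)) (fun n => by
        rw [add_zero]; split_ifs <;> simp),
    star_weightedShift 1 _ _ (norm_ite_rho_le e α)
      (norm_ite_rho_sub_one_le e fun n => star (α n)) (fun n => by
        simp only [hpar, add_sub_cancel_right, cmvRho_star]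
        split_ifs <;> simp_all),
    star_weightedShift (-1) _ _ (norm_ite_rho_sub_one_le e α)
      (norm_ite_rho_le e fun n => star (α n)) (fun n => by
        simp only [← sub_eq_add_neg, hpar', cmvRho_star]
        split_ifs <;> simp_all)]
  rw [cmvFactor, neg_zero, neg_neg, add_right_comm]

lemma cmvFactor_star_mul_self (e : ℤ) (α : ℤ → 𝔻) :
    cmvFactor e (fun n => star (α n)) * cmvFactor e α = 1 := by
  ext u n
  have h : (cmvFactor e α u : ℤ → ℂ) = cmvFactorSeq e α u := funext (cmvFactor_apply e α u)
  change cmvFactor e (fun n => star (α n)) (cmvFactor e α u) n = u n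
  rw [cmvFactor_apply, h, cmvFactorSeq_star_cmvFactorSeq]

lemma cmvFactor_mem_unitary (e : ℤ) (α : ℤ → 𝔻) :
    cmvFactor e α ∈ unitary (ellTwo →L[ℂ] ellTwo) := by
  rw [Unitary.mem_iff, star_cmvFactor]
  refine ⟨cmvFactor_star_mul_self e α, ?_⟩
  have := cmvFactor_star_mul_self e fun n => star (α n)
  simpa using this

lemma extendedCMV_eq_mul (α : ℤ → 𝔻) : extendedCMV α = cmvFactor 0 α * cmvFactor 1 α := by
  ext u n
  have h : (cmvFactor 1 α u : ℤ → ℂ) = cmvFactorSeq 1 α u := funext (cmvFactor_apply 1 α u)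
  change _ = cmvFactor 0 α (cmvFactor 1 α u) n
  rw [cmvFactor_apply, h, ← cmvSeq_eq, extendedCMV_apply]
  rfl

lemma extendedCMV_mem_unitary (α : ℤ → 𝔻) : extendedCMV α ∈ unitary (ellTwo →L[ℂ] ellTwo) := by
  rw [extendedCMV_eq_mul]
  exact mul_mem (cmvFactor_mem_unitary 0 α) (cmvFactor_mem_unitary 1 α)

/-- A point of the circle at which a unitary operator is bounded below lies in the resolvent set. -/
lemma notMem_spectrum_of_unitary {H : Type*} [NormedAddCommGroup H] [InnerProductSpace ℂ H]
    [CompleteSpace H] {U : H →L[ℂ] H} (hU : U ∈ unitary (H →L[ℂ] H)) {z : ℂ} (hz : ‖z‖ = 1) {C : ℝ}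
    (hC : ∀ u, ‖u‖ ≤ C * ‖U u - z • u‖) : z ∉ spectrum ℂ U := by
  rw [spectrum.notMem_iff]
  have hC' : ∀ u, ‖u‖ ≤ C * ‖(algebraMap ℂ (H →L[ℂ] H) z - U) u‖ := fun u => by
    refine (hC u).trans_eq ?_
    rw [norm_sub_rev]
    rfl
  set R := algebraMap ℂ (H →L[ℂ] H) z - U with hR
  have hzz : conj z * z = 1 := by
    rw [mul_comm, Complex.mul_conj, Complex.normSq_eq_norm_sq, hz]; simp
  have hanti : AntilipschitzWith (Real.toNNReal C) R :=
    AddMonoidHomClass.antilipschitz_of_bound R fun u => (hC' u).trans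
      (mul_le_mul_of_nonneg_right (Real.le_coe_toNNReal C) (norm_nonneg _))
  have hclosed : IsClosed (Set.range R) := hanti.isClosed_range R.uniformContinuous
  -- The range is closed, so it remains to kill its orthogonal complement. There `U* x = conj z •
  -- x`, which for a unitary `U` means `U x = z • x`, and the lower bound gives `x = 0`.
  have hker : ∀ x : H, (∀ y, inner ℂ (R y) x = 0) → x = 0 := fun x hx => by
    have h1 : ContinuousLinearMap.adjoint R x = 0 := by
      refine ext_inner_left ℂ fun y => ?_
      rw [ContinuousLinearMap.adjoint_inner_right, hx, inner_zero_right]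
    have h2 : ContinuousLinearMap.adjoint R = algebraMap ℂ (H →L[ℂ] H) (conj z) - star U := by
      rw [← ContinuousLinearMap.star_eq_adjoint, hR, star_sub, ← algebraMap_star_comm]
      rfl
    rw [h2] at h1
    have h3 : conj z • x = star U x := sub_eq_zero.1 h1
    have h4 : U (star U x) = x := congrArg (fun B : H →L[ℂ] H => B x) (Unitary.mul_star_self_of_mem hU)
    rw [← h3, map_smul] at h4
    have h5 : R x = 0 := by
      change z • x - U x = 0
      nth_rw 1 [← h4]
      rw [smul_smul, mul_comm, hzz, one_smul, sub_self]
    have := hC' x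
    rw [h5, norm_zero, mul_zero] at this
    exact norm_le_zero_iff.1 this
  have hrange : R.range = ⊤ := by
    have hcl : IsClosed (R.range : Set H) := by
      rw [LinearMap.coe_range]
      exact hclosed
    rw [← hcl.submodule_topologicalClosure_eq, Submodule.topologicalClosure_eq_top_iff,
      Submodule.eq_bot_iff]
    intro x hx
    rw [Submodule.mem_orthogonal] at hx
    exact hker x fun y => hx _ ⟨y, rfl⟩
  rw [ContinuousLinearMap.isUnit_iff_bijective]
  exact ⟨hanti.injective, LinearMap.range_eq_top.1 hrange⟩

lemma exists_bound_of_notMem_spectrum {H : Type*} [NormedAddCommGroup H] [NormedSpace ℂ H]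
    {U : H →L[ℂ] H} {z : ℂ} (hz : z ∉ spectrum ℂ U) :
    ∃ C : ℝ, 0 ≤ C ∧ ∀ u, ‖u‖ ≤ C * ‖U u - z • u‖ := by
  rw [spectrum.notMem_iff] at hz
  obtain ⟨R, hR⟩ := hz
  refine ⟨‖(↑R⁻¹ : H →L[ℂ] H)‖, norm_nonneg _, fun u => ?_⟩
  have h1 : (↑R⁻¹ : H →L[ℂ] H) ((R : H →L[ℂ] H) u) = u :=
    congrArg (fun B : H →L[ℂ] H => B u) R.inv_mul
  have h2 : (R : H →L[ℂ] H) u = z • u - U u := by rw [hR]; rfl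
  rw [h2] at h1
  rw [norm_sub_rev]
  conv_lhs => rw [← h1]
  exact ContinuousLinearMap.le_opNorm _ _

/-! ### The Szegő recursion and generalized eigenfunctions -/

lemma szegoElt_apply_zero (α : 𝔻) (z : Circle) (x : C2) :
    matOp (szegoElt α z) x 0 = ((z : ℂ) * x 0 - conj (α : ℂ) * x 1) / (cmvRho α : ℂ) := by
  rw [matOp_apply_zero]
  change szegoMatrix α z 0 0 * x 0 + szegoMatrix α z 0 1 * x 1 = _
  simp [szegoMatrix]
  ring

lemma szegoElt_apply_one (α : 𝔻) (z : Circle) (x : C2) :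
    matOp (szegoElt α z) x 1 = (x 1 - (α : ℂ) * z * x 0) / (cmvRho α : ℂ) := by
  rw [matOp_apply_one]
  change szegoMatrix α z 1 0 * x 0 + szegoMatrix α z 1 1 * x 1 = _
  simp [szegoMatrix]
  ring

lemma continuous_cmvRho : Continuous cmvRho := by
  unfold cmvRho
  exact Real.continuous_sqrt.comp
    (continuous_const.sub (Complex.UnitDisc.continuous_coe.norm.pow 2))

lemma continuous_szegoMatrix (z : Circle) : Continuous fun α : 𝔻 => szegoMatrix α z := by
  have hρ : Continuous fun α : 𝔻 => 1 / (cmvRho α : ℂ) :=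
    continuous_const.div (Complex.continuous_ofReal.comp continuous_cmvRho) ofReal_cmvRho_ne_zero
  refine hρ.smul (continuous_matrix fun i j => ?_)
  have hα := Complex.UnitDisc.continuous_coe
  have hα' := Complex.continuous_conj.comp hα
  fin_cases i <;> fin_cases j
  · exact continuous_const
  · exact hα'.neg
  · exact hα.neg.mul continuous_const
  · exact continuous_const

lemma continuous_szegoElt (z : Circle) : Continuous fun α : 𝔻 => szegoElt α z := by
  refine Continuous.subtype_mk (Units.continuous_iff.2 ⟨continuous_szegoMatrix z, ?_⟩) _
  have h : ∀ α : 𝔻, (((szegoElt α z : GL (Fin 2) ℂ)⁻¹ : GL (Fin 2) ℂ) : Matrix (Fin 2) (Fin 2) ℂ) =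
      (z : ℂ)⁻¹ • (szegoMatrix α z).adjugate := fun α => by
    rw [Matrix.coe_units_inv]
    change (szegoMatrix α z)⁻¹ = _
    rw [Matrix.inv_def, szegoMatrix_det, Ring.inverse_eq_inv']
  have h' : Continuous fun α : 𝔻 => (z : ℂ)⁻¹ • (szegoMatrix α z).adjugate :=
    continuous_matrix fun i j =>
      continuous_const.mul ((continuous_szegoMatrix z).matrix_adjugate.matrix_elem i j)
  exact (continuous_congr h).2 h'

lemma continuous_szegoCocycle {Ω : Type*} [TopologicalSpace Ω] {f : Ω → 𝔻} (hf : Continuous f)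
    (z : Circle) : Continuous (szegoCocycle f z) :=
  (continuous_szegoElt z).comp hf

/-- The sequence in `ℂ²` that turns `y = M u`, `L y = z u` into the Szegő recursion. -/
def szegoVec (z : Circle) (u y : ℤ → ℂ) (n : ℤ) : C2 :=
  ((z : ℂ) ^ (n / 2)) • (if Even n then !₂[u n, y n] else !₂[y n, z * u n])

lemma szegoVec_two_mul (z : Circle) (u y : ℤ → ℂ) (k : ℤ) :
    szegoVec z u y (2 * k) = ((z : ℂ) ^ k) • !₂[u (2 * k), y (2 * k)] := by
  rw [szegoVec, if_pos (even_two_mul k), Int.mul_ediv_cancel_left _ two_ne_zero]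

lemma szegoVec_two_mul_add_one (z : Circle) (u y : ℤ → ℂ) (k : ℤ) :
    szegoVec z u y (2 * k + 1) = ((z : ℂ) ^ k) • !₂[y (2 * k + 1), z * u (2 * k + 1)] := by
  rw [szegoVec, if_neg (Int.not_even_two_mul_add_one k), show (2 * k + 1) / 2 = k by omega]

lemma norm_szegoVec_sq (z : Circle) (u y : ℤ → ℂ) (n : ℤ) :
    ‖szegoVec z u y n‖ ^ 2 = ‖u n‖ ^ 2 + ‖y n‖ ^ 2 := by
  rw [szegoVec, norm_smul, norm_zpow, Circle.norm_coe, one_zpow, one_mul, C2.norm_sq]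
  split_ifs
  · simp
  · simp [add_comm, Circle.norm_coe]

/-- The step from an odd site uses only `y = M u`, which holds exactly, so no defect arises. -/
lemma szegoVec_defect_odd {α : ℤ → 𝔻} {z : Circle} {u y : ℤ → ℂ}
    (hy : ∀ n, y n = cmvFactorSeq 1 α u n) (k : ℤ) :
    szegoVec z u y (2 * k + 1 + 1) -
      matOp (szegoElt (α (2 * k + 1)) z) (szegoVec z u y (2 * k + 1)) = 0 := by
  have he : Even (2 * k + 1 + 1) := ⟨k + 1, by ring⟩
  have h1 := hy (2 * k + 1)
  have h2 := hy (2 * k + 1 + 1)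
  rw [cmvFactorSeq_of_even he] at h1
  rw [cmvFactorSeq_add_one_of_even he] at h2
  have hρ := ofReal_cmvRho_ne_zero (α (2 * k + 1))
  have hρ2 := ofReal_cmvRho_sq (α (2 * k + 1))
  rw [szegoVec_two_mul_add_one, map_smul, show 2 * k + 1 + 1 = 2 * (k + 1) by ring,
    szegoVec_two_mul, zpow_add_one₀ z.coe_ne_zero, mul_smul, ← smul_sub]
  rw [show 2 * k + 1 + 1 = 2 * (k + 1) by ring] at h1 h2
  refine smul_eq_zero_of_right _ ?_
  ext i
  fin_cases i
  · change (z : ℂ) * u (2 * (k + 1)) - matOp _ _ 0 = 0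
    rw [szegoElt_apply_zero]
    simp only [Matrix.cons_val_zero, Matrix.cons_val_one]
    rw [h1]
    field_simp
    ring
  · change (z : ℂ) * y (2 * (k + 1)) - matOp _ _ 1 = 0
    rw [szegoElt_apply_one]
    simp only [Matrix.cons_val_zero, Matrix.cons_val_one]
    rw [h1, h2]
    field_simp
    linear_combination (z * u (2 * k + 1)) * hρ2

/-- The step from an even site uses the other factor, so the error `g` in `L y = z u` appears here.
-/
lemma szegoVec_defect_even {α : ℤ → 𝔻} {z : Circle} {u y g : ℤ → ℂ}
    (hg : ∀ n, g n = cmvFactorSeq 0 α y n - z * u n) (k : ℤ) :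
    szegoVec z u y (2 * k + 1) - matOp (szegoElt (α (2 * k)) z) (szegoVec z u y (2 * k)) =
      ((z : ℂ) ^ k) • !₂[g (2 * k) / (cmvRho (α (2 * k)) : ℂ),
        -(α (2 * k) : ℂ) * g (2 * k) / (cmvRho (α (2 * k)) : ℂ) - g (2 * k + 1)] := by
  have he : Even (2 * k + 0) := ⟨k, by ring⟩
  have h1 := hg (2 * k)
  have h2 := hg (2 * k + 1)
  rw [cmvFactorSeq_of_even he] at h1
  rw [cmvFactorSeq_add_one_of_even he] at h2
  have hρ := ofReal_cmvRho_ne_zero (α (2 * k))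
  have hρ2 := ofReal_cmvRho_sq (α (2 * k))
  rw [szegoVec_two_mul, map_smul, szegoVec_two_mul_add_one, ← smul_sub]
  congr 1
  ext i
  fin_cases i
  · change y (2 * k + 1) - matOp _ _ 0 = g (2 * k) / _
    rw [szegoElt_apply_zero]
    simp only [Matrix.cons_val_zero, Matrix.cons_val_one]
    rw [h1]
    field_simp
    ring
  · change (z : ℂ) * u (2 * k + 1) - matOp _ _ 1 = -(α (2 * k) : ℂ) * g (2 * k) / _ - g (2 * k + 1)
    rw [szegoElt_apply_one]
    simp only [Matrix.cons_val_zero, Matrix.cons_val_one]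
    rw [h1, h2]
    field_simp
    linear_combination (y (2 * k)) * hρ2

lemma szegoVec_defect_sq_le {α : ℤ → 𝔻} {z : Circle} {u y g : ℤ → ℂ}
    (hy : ∀ n, y n = cmvFactorSeq 1 α u n) (hg : ∀ n, g n = cmvFactorSeq 0 α y n - z * u n)
    {r : ℝ} (hr : 0 < r) (hα : ∀ n, r ≤ cmvRho (α n)) (n : ℤ) :
    ‖szegoVec z u y (n + 1) - matOp (szegoElt (α n) z) (szegoVec z u y n)‖ ^ 2 ≤
      (3 / r ^ 2 + 2) * (‖g n‖ ^ 2 + ‖g (n + 1)‖ ^ 2) := by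
  obtain ⟨k, rfl | rfl⟩ := Int.even_or_odd' n
  · rw [szegoVec_defect_even hg, norm_smul, norm_zpow, Circle.norm_coe, one_zpow, one_mul,
      C2.norm_sq]
    simp only [Matrix.cons_val_zero, Matrix.cons_val_one]
    have hρ0 := cmvRho_pos (α (2 * k))
    have hG : ‖g (2 * k) / (cmvRho (α (2 * k)) : ℂ)‖ ≤ ‖g (2 * k)‖ / r := by
      rw [norm_div, Complex.norm_real, Real.norm_of_nonneg hρ0.le]
      gcongr
      exact hα _
    have hG2 : ‖-(α (2 * k) : ℂ) * g (2 * k) / (cmvRho (α (2 * k)) : ℂ)‖ ≤ ‖g (2 * k)‖ / r := by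
      rw [mul_div_assoc, norm_mul, norm_neg]
      exact (mul_le_of_le_one_left (norm_nonneg _) (α (2 * k)).norm_lt_one.le).trans hG
    have h3 := (norm_sub_le (-(α (2 * k) : ℂ) * g (2 * k) / (cmvRho (α (2 * k)) : ℂ))
      (g (2 * k + 1))).trans (add_le_add_left hG2 _)
    set q := ‖g (2 * k)‖ / r with hq
    have hq0 : 0 ≤ q := by positivity
    have h4 : ‖g (2 * k) / (cmvRho (α (2 * k)) : ℂ)‖ ^ 2 ≤ q ^ 2 := by gcongr
    have h5 : ‖-(α (2 * k) : ℂ) * g (2 * k) / (cmvRho (α (2 * k)) : ℂ) - g (2 * k + 1)‖ ^ 2 ≤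
        (q + ‖g (2 * k + 1)‖) ^ 2 := by gcongr
    have h6 : 3 / r ^ 2 * ‖g (2 * k)‖ ^ 2 = 3 * q ^ 2 := by rw [hq]; field_simp
    have h7 : 0 ≤ 3 / r ^ 2 * ‖g (2 * k + 1)‖ ^ 2 := by positivity
    -- With `b = ‖g (2 * k + 1)‖` this rests on `q² + (q + b)² ≤ 3 q² + 2 b²`, the source of `3 / r
    -- ^ 2 + 2`.
    nlinarith [sq_nonneg (q - ‖g (2 * k + 1)‖), sq_nonneg ‖g (2 * k)‖]
  · rw [szegoVec_defect_odd hy, norm_zero, zero_pow two_ne_zero]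
    positivity

/-- Solutions of the Szegő recursion come from generalized eigenfunctions. -/
lemma exists_generalized_eigenfunction {α : ℤ → 𝔻} {z : Circle} {V : ℤ → C2}
    (hV : ∀ n, V (n + 1) = matOp (szegoElt (α n) z) (V n)) :
    ∃ u y : ℤ → ℂ, (∀ n, ‖u n‖ ^ 2 + ‖y n‖ ^ 2 = ‖V n‖ ^ 2) ∧
      (∀ n, y n = cmvFactorSeq 1 α u n) ∧ ∀ n, cmvFactorSeq 0 α y n = z * u n := by
  -- These formulas invert `szegoVec`.
  let u : ℤ → ℂ := fun n => ((z : ℂ) ^ (n / 2))⁻¹ * (if Even n then V n 0 else (z : ℂ)⁻¹ * V n 1)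
  let y : ℤ → ℂ := fun n => ((z : ℂ) ^ (n / 2))⁻¹ * (if Even n then V n 1 else V n 0)
  have hz := z.coe_ne_zero
  have hu0 : ∀ k, u (2 * k) = ((z : ℂ) ^ k)⁻¹ * V (2 * k) 0 := fun k => by
    simp only [u]
    rw [if_pos (even_two_mul k), Int.mul_ediv_cancel_left _ two_ne_zero]
  have hy0 : ∀ k, y (2 * k) = ((z : ℂ) ^ k)⁻¹ * V (2 * k) 1 := fun k => by
    simp only [y]
    rw [if_pos (even_two_mul k), Int.mul_ediv_cancel_left _ two_ne_zero]
  have hu1 : ∀ k, u (2 * k + 1) = ((z : ℂ) ^ k)⁻¹ * ((z : ℂ)⁻¹ * V (2 * k + 1) 1) := fun k => by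
    simp only [u]
    rw [if_neg (Int.not_even_two_mul_add_one k), show (2 * k + 1) / 2 = k by omega]
  have hy1 : ∀ k, y (2 * k + 1) = ((z : ℂ) ^ k)⁻¹ * V (2 * k + 1) 0 := fun k => by
    simp only [y]
    rw [if_neg (Int.not_even_two_mul_add_one k), show (2 * k + 1) / 2 = k by omega]
  refine ⟨u, y, fun n => ?_, fun n => ?_, fun n => ?_⟩
  · rw [C2.norm_sq]
    obtain ⟨k, rfl | rfl⟩ := Int.even_or_odd' n
    · rw [hu0, hy0]; simp [Circle.norm_coe]
    · rw [hu1, hy1]; simp [Circle.norm_coe, add_comm]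
  · rcases even_or_exists_add_one 1 n with h | ⟨m, rfl, h⟩
    · obtain ⟨k, rfl⟩ : ∃ k, n = 2 * k + 1 := by
        obtain ⟨j, hj⟩ := h
        exact ⟨j - 1, by omega⟩
      have h0 := szegoElt_apply_zero (α (2 * k + 1)) z (V (2 * k + 1))
      have hρ := ofReal_cmvRho_ne_zero (α (2 * k + 1))
      rw [← hV] at h0
      rw [cmvFactorSeq_of_even h, hy1, hu1, show 2 * k + 1 + 1 = 2 * (k + 1) by ring, hu0,
        show 2 * (k + 1) = 2 * k + 1 + 1 by ring, h0, zpow_add_one₀ hz]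
      field_simp
      ring
    · obtain ⟨k, rfl⟩ : ∃ k, m = 2 * k + 1 := by
        obtain ⟨j, hj⟩ := h
        exact ⟨j - 1, by omega⟩
      have h0 := szegoElt_apply_zero (α (2 * k + 1)) z (V (2 * k + 1))
      have h1 := szegoElt_apply_one (α (2 * k + 1)) z (V (2 * k + 1))
      have hρ := ofReal_cmvRho_ne_zero (α (2 * k + 1))
      have hρ2 := ofReal_cmvRho_sq (α (2 * k + 1))
      rw [← hV] at h0 h1
      rw [cmvFactorSeq_add_one_of_even h, hu1, show 2 * k + 1 + 1 = 2 * (k + 1) by ring, hu0, hy0,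
        show 2 * (k + 1) = 2 * k + 1 + 1 by ring, h0, h1, zpow_add_one₀ hz]
      field_simp
      linear_combination (-V (2 * k + 1) 1) * hρ2
  · rcases even_or_exists_add_one 0 n with h | ⟨m, rfl, h⟩
    · obtain ⟨k, rfl⟩ : ∃ k, n = 2 * k := by
        obtain ⟨j, hj⟩ := h
        exact ⟨j, by omega⟩
      have h0 := szegoElt_apply_zero (α (2 * k)) z (V (2 * k))
      have hρ := ofReal_cmvRho_ne_zero (α (2 * k))
      rw [← hV] at h0
      rw [cmvFactorSeq_of_even h, hy0, hy1, hu0, h0]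
      field_simp
      ring
    · obtain ⟨k, rfl⟩ : ∃ k, m = 2 * k := by
        obtain ⟨j, hj⟩ := h
        exact ⟨j, by omega⟩
      have h0 := szegoElt_apply_zero (α (2 * k)) z (V (2 * k))
      have h1 := szegoElt_apply_one (α (2 * k)) z (V (2 * k))
      have hρ := ofReal_cmvRho_ne_zero (α (2 * k))
      have hρ2 := ofReal_cmvRho_sq (α (2 * k))
      rw [← hV] at h0 h1
      rw [cmvFactorSeq_add_one_of_even h, hy0, hy1, hu1, h0, h1]
      field_simp
      linear_combination (V (2 * k) 1) * hρ2

/-! ### The tent cutoff -/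

/-- The tent function of radius `R` around `m`. -/
def tent (m : ℤ) (R : ℕ) (n : ℤ) : ℝ := max (1 - |(n : ℝ) - m| / R) 0

lemma abs_tent_sub_le (m : ℤ) (R : ℕ) (a b : ℤ) :
    |tent m R a - tent m R b| ≤ |(a : ℝ) - b| / R := by
  refine (abs_max_sub_max_le_abs _ _ _).trans ?_
  rw [show 1 - |(a : ℝ) - m| / R - (1 - |(b : ℝ) - m| / R) = (|(b : ℝ) - m| - |(a : ℝ) - m|) / R by
    ring, abs_div, Nat.abs_cast]
  have h := abs_abs_sub_abs_le ((b : ℝ) - m) ((a : ℝ) - m)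
  rw [sub_sub_sub_cancel_right, abs_sub_comm (b : ℝ) a] at h
  exact div_le_div_of_nonneg_right h (Nat.cast_nonneg R)

lemma tent_eq_zero {m : ℤ} {R : ℕ} (hR : 0 < R) {n : ℤ} (h : (R : ℤ) ≤ |n - m|) :
    tent m R n = 0 := by
  have hR' : (0 : ℝ) < R := by exact_mod_cast hR
  refine max_eq_right ?_
  have h' : (R : ℝ) ≤ |(n : ℝ) - m| := by exact_mod_cast h
  have := (one_le_div hR').2 h'
  linarith

lemma half_le_tent {m : ℤ} {R : ℕ} (hR : 2 ≤ R) {n : ℤ} (h : |n - m| ≤ 1) :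
    1 / 2 ≤ tent m R n := by
  have hR' : (2 : ℝ) ≤ R := by exact_mod_cast hR
  refine le_max_of_le_left ?_
  have h' : |(n : ℝ) - m| ≤ 1 := by exact_mod_cast h
  have : |(n : ℝ) - m| / R ≤ 1 / 2 := by gcongr
  linarith

/-- The solution is normalized as a pair `(u, y)`, but the test vector is built from `u` alone.
Since `y m` depends on `u` only at neighbouring sites, `u` cannot be small at all of them. -/
lemma exists_quarter_le_norm {α : ℤ → 𝔻} {u y : ℤ → ℂ} (hy : ∀ n, y n = cmvFactorSeq 1 α u n)
    {m : ℤ} (hm : ‖u m‖ ^ 2 + ‖y m‖ ^ 2 = 1) : ∃ j, |j - m| ≤ 1 ∧ 1 / 4 ≤ ‖u j‖ := by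
  by_contra! hcon
  have h0 := hcon m (by simp)
  have h1 := hcon (m + 1) (by simp)
  have h2 := hcon (m - 1) (by simp)
  have hprod : ∀ a b : ℂ, ‖a‖ ≤ 1 → ‖b‖ < 1 / 4 → ‖a * b‖ ≤ 1 / 4 := fun a b ha hb => by
    rw [norm_mul]
    exact (mul_le_of_le_one_left (norm_nonneg _) ha).trans hb.le
  have hyle : ‖y m‖ ≤ 1 / 2 := by
    rw [hy, cmvFactorSeq]
    split_ifs
    · refine (norm_add_le _ _).trans ?_
      have ha := hprod (conj (α m : ℂ)) (u m)
        (by rw [RCLike.norm_conj]; exact (α m).norm_lt_one.le) h0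
      have hb := hprod (cmvRho (α m) : ℂ) (u (m + 1)) (norm_cmvRho_le _) h1
      linarith
    · refine (norm_sub_le _ _).trans ?_
      have ha := hprod (α (m - 1) : ℂ) (u m) (α (m - 1)).norm_lt_one.le h0
      have hb := hprod (cmvRho (α (m - 1)) : ℂ) (u (m - 1)) (norm_cmvRho_le _) h2
      linarith
  nlinarith [norm_nonneg (y m), norm_nonneg (u m)]

/-- On the cut-off solution only the commutator of the operator with the tent survives. Each of five
terms is at most `(2 / R) * 2`, which gives `20 / R` per site on `2 * R + 5` sites. The window `R +
4` is the support `R + 2` of the commutator widened by the band width 2, and 1/64 is the square of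
(1/2) * (1/4). -/
lemma lower_bound_of_long_solution {α : ℤ → 𝔻} {z : ℂ} {C : ℝ}
    (hC : ∀ x, ‖x‖ ≤ C * ‖extendedCMV α x - z • x‖) {u y : ℤ → ℂ}
    (hy : ∀ n, y n = cmvFactorSeq 1 α u n) (hu : ∀ n, cmvFactorSeq 0 α y n = z * u n)
    {m : ℤ} {R : ℕ} (hR : 2 ≤ R) (hm : ‖u m‖ ^ 2 + ‖y m‖ ^ 2 = 1)
    (hb : ∀ n, |n - m| ≤ R + 4 → ‖u n‖ ≤ 2) :
    1 / 64 ≤ C ^ 2 * ((2 * R + 5) * (400 / R ^ 2)) := by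
  have hR0 : (0 : ℝ) < R := by exact_mod_cast (by omega : 0 < R)
  have hsupp : ∀ n ∉ Finset.Icc (m - R) (m + R), (tent m R n : ℂ) * u n = 0 := fun n hn => by
    rw [tent_eq_zero (by omega), Complex.ofReal_zero, zero_mul]
    rw [Finset.mem_Icc] at hn
    rw [le_abs]
    omega
  let x : ellTwo := ⟨fun n => (tent m R n : ℂ) * u n, memℓp_gen (summable_of_ne_finset_zero
    (s := Finset.Icc (m - R) (m + R)) fun n hn => by rw [hsupp n hn]; simp)⟩
  have hx : ∀ n, x n = (tent m R n : ℂ) * u n := fun n => rfl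
  have hg : ∀ n, (extendedCMV α x - z • x) n = ∑ k ∈ Finset.Icc (-2 : ℤ) 2,
      cmvEntry α n (n + k) * (((tent m R (n + k) - tent m R n : ℝ) : ℂ) * u (n + k)) := fun n => by
    have h1 : z * u n = cmvSeq α u n := by
      rw [cmvSeq_eq, ← hu, funext hy]
    have h2 : (z • x) n = (tent m R n : ℂ) * cmvSeq α u n := by
      rw [← h1, lp.coeFn_smul, Pi.smul_apply, hx, smul_eq_mul]; ring
    rw [lp.coeFn_sub, Pi.sub_apply, h2, extendedCMV_apply, cmvSeq, Finset.mul_sum,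
      ← Finset.sum_sub_distrib]
    refine Finset.sum_congr rfl fun k _ => ?_
    rw [hx]
    push_cast
    ring
  have hgle : ∀ n ∈ Finset.Icc (m - (R + 2)) (m + (R + 2)),
      ‖(extendedCMV α x - z • x) n‖ ^ 2 ≤ 400 / R ^ 2 := fun n hn => by
    rw [Finset.mem_Icc] at hn
    have h1 : ‖(extendedCMV α x - z • x) n‖ ≤ 20 / R := by
      rw [hg]
      refine (norm_sum_le_of_le (n := fun _ : ℤ => 4 / (R : ℝ)) _ fun k hk => ?_).trans_eq ?_
      · rw [Finset.mem_Icc] at hk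
        rw [norm_mul, norm_mul, Complex.norm_real, Real.norm_eq_abs]
        have h2 := abs_tent_sub_le m R (n + k) n
        have h3 : |((n + k : ℤ) : ℝ) - n| ≤ 2 := by
          have : |k| ≤ 2 := abs_le.2 hk
          push_cast
          rw [add_sub_cancel_left]
          exact_mod_cast this
        have h4 : ‖u (n + k)‖ ≤ 2 := hb _ (by rw [abs_le]; omega)
        calc _ ≤ 1 * (2 / (R : ℝ) * 2) := by
              gcongr
              · exact norm_cmvEntry_le _ _ _
              · exact h2.trans (by gcongr)
          _ = 4 / (R : ℝ) := by ring
      · simp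
        ring
    calc ‖(extendedCMV α x - z • x) n‖ ^ 2 ≤ (20 / (R : ℝ)) ^ 2 := by gcongr
      _ = 400 / (R : ℝ) ^ 2 := by ring
  have hg0 : ∀ n ∉ Finset.Icc (m - (R + 2)) (m + (R + 2)),
      ‖(extendedCMV α x - z • x) n‖ ^ 2 = 0 := fun n hn => by
    rw [Finset.mem_Icc] at hn
    rw [hg, Finset.sum_eq_zero, norm_zero, zero_pow two_ne_zero]
    intro k hk
    rw [Finset.mem_Icc] at hk
    rw [tent_eq_zero (by omega) (by rw [le_abs]; omega),
      tent_eq_zero (by omega) (by rw [le_abs]; omega)]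
    simp
  have hnorm : ‖extendedCMV α x - z • x‖ ^ 2 ≤ (2 * R + 5) * (400 / R ^ 2) := by
    rw [(ellTwo_hasSum_norm_sq _).unique (hasSum_sum_of_ne_finset_zero hg0)]
    refine (Finset.sum_le_card_nsmul _ _ _ hgle).trans_eq ?_
    rw [nsmul_eq_mul, Int.card_Icc]
    congr 1
    have : (m + (R + 2) + 1 - (m - (R + 2))).toNat = 2 * R + 5 := by omega
    rw [this]
    push_cast
    ring
  obtain ⟨j, hj, hju⟩ := exists_quarter_le_norm hy hm
  have hxj : 1 / 8 ≤ ‖x‖ := by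
    refine le_trans ?_ (lp.norm_apply_le_norm two_ne_zero x j)
    have h1 := half_le_tent hR hj
    rw [hx, norm_mul, Complex.norm_real, Real.norm_of_nonneg (by linarith)]
    nlinarith
  calc (1 / 64 : ℝ) = (1 / 8) ^ 2 := by norm_num
    _ ≤ ‖x‖ ^ 2 := by gcongr
    _ ≤ (C * ‖extendedCMV α x - z • x‖) ^ 2 := by gcongr; exact hC x
    _ = C ^ 2 * ‖extendedCMV α x - z • x‖ ^ 2 := mul_pow _ _ _
    _ ≤ _ := by gcongr

/-! ### The spectrum -/

section Spectrum

variable {Ω : Type*} [MetricSpace Ω] {T : Ω ≃ₜ Ω} {f : Ω → 𝔻} {z : Circle}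

lemma notMem_spectrum_of_not_hasSackerSell [CompactSpace Ω] (hf : Continuous f)
    (h : ¬ HasSackerSell T (szegoCocycle f z)) (ω : Ω) :
    (z : ℂ) ∉ spectrum ℂ (extendedCMV fun n : ℤ => f ((T ^ n) ω)) := by
  obtain ⟨C, hC0, hC⟩ := exists_sum_norm_sq_le (continuous_szegoCocycle hf z) h
  -- The defect divides by `ρ`, so a uniform positive lower bound is needed; compactness supplies
  -- it.
  obtain ⟨ω₀, -, hω₀⟩ := isCompact_univ.exists_isMinOn ⟨ω, trivial⟩
    (continuous_cmvRho.comp hf).continuousOn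
  set r := cmvRho (f ω₀) with hr
  have hr0 : 0 < r := cmvRho_pos _
  set α : ℤ → 𝔻 := fun n => f ((T ^ n) ω) with hα
  have hαr : ∀ n, r ≤ cmvRho (α n) := fun n => hω₀ (Set.mem_univ ((T ^ n) ω))
  set c : ℝ := 3 / r ^ 2 + 2 with hc
  have hc0 : 0 ≤ c := by positivity
  refine notMem_spectrum_of_unitary (extendedCMV_mem_unitary α) z.norm_coe
    (C := Real.sqrt (C * (c * 2))) fun u => ?_
  set g : ellTwo := extendedCMV α u - (z : ℂ) • u with hg
  set y : ellTwo := cmvFactor 1 α u with hy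
  have hyn : ∀ n, y n = cmvFactorSeq 1 α u n := cmvFactor_apply 1 α u
  have hgn : ∀ n, g n = cmvFactorSeq 0 α y n - z * u n := fun n => by
    have h1 : extendedCMV α u = cmvFactor 0 α y := by rw [extendedCMV_eq_mul]; rfl
    rw [hg, h1, lp.coeFn_sub, Pi.sub_apply, cmvFactor_apply]
    rfl
  have hdef := szegoVec_defect_sq_le hyn hgn hr0 hαr
  have hgs := ellTwo_hasSum_norm_sq g
  have hgs' : HasSum (fun n : ℤ => ‖g (n + 1)‖ ^ 2) (‖g‖ ^ 2) :=
    (Equiv.addRight (1 : ℤ)).hasSum_iff.2 hgs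
  have hbound := (hgs.add hgs').mul_left c
  have hsum := hbound.summable.of_nonneg_of_le (fun n => by positivity) hdef
  have hmain := hC ω (szegoVec z u y) (‖u‖ + ‖y‖) (fun n => by
    have h1 := norm_szegoVec_sq z u y n
    have h2 := lp.norm_apply_le_norm two_ne_zero u n
    have h3 := lp.norm_apply_le_norm two_ne_zero y n
    refine abs_le_of_sq_le_sq' ?_ (by positivity) |>.2
    rw [h1]
    nlinarith [norm_nonneg (u n), norm_nonneg (y n)]) hsum
  have hts : ∑' n : ℤ, ‖szegoVec z u y (n + 1) -
      matOp (szegoCocycle f z ((T ^ n) ω)) (szegoVec z u y n)‖ ^ 2 ≤ c * (‖g‖ ^ 2 + ‖g‖ ^ 2) := by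
    rw [← hbound.tsum_eq]
    exact Summable.tsum_le_tsum hdef hsum hbound.summable
  have hu2 : ‖u‖ ^ 2 ≤ C * (c * 2) * ‖g‖ ^ 2 := by
    refine hasSum_le_of_sum_le (ellTwo_hasSum_norm_sq u) fun s => ?_
    calc ∑ n ∈ s, ‖u n‖ ^ 2 ≤ ∑ n ∈ s, ‖szegoVec z u y n‖ ^ 2 :=
          Finset.sum_le_sum fun n _ => by rw [norm_szegoVec_sq]; linarith [sq_nonneg ‖y n‖]
      _ ≤ C * (c * (‖g‖ ^ 2 + ‖g‖ ^ 2)) := (hmain s).trans (by gcongr)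
      _ = _ := by ring
  refine abs_le_of_sq_le_sq' ?_ (by positivity) |>.2
  rw [mul_pow, Real.sq_sqrt (by positivity)]
  exact hu2

lemma mem_spectrum_of_hasSackerSell (hT : IsMinimalHomeo T) (hf : Continuous f)
    (h : HasSackerSell T (szegoCocycle f z)) (ω : Ω) :
    (z : ℂ) ∈ spectrum ℂ (extendedCMV fun n : ℤ => f ((T ^ n) ω)) := by
  by_contra hz
  obtain ⟨C, hC0, hC⟩ := exists_bound_of_notMem_spectrum hz
  obtain ⟨ω', v, hv, hle⟩ := h
  have hA := continuous_szegoCocycle hf z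
  have hlow : ∀ R : ℕ, 2 ≤ R → 1 / 64 ≤ C ^ 2 * ((2 * R + 5) * (400 / (R : ℝ) ^ 2)) := by
    intro R hR
    -- Relaxing the bound from `≤ 1` to `< 2` on finitely many times makes it open in the base
    -- point, so some point `T ^ m ω` of the dense orbit satisfies it.
    have hopen : IsOpen (⋂ k ∈ Finset.Icc (-((R : ℤ) + 4)) (R + 4),
        {x : Ω | ‖matOp (cocycleIter T (szegoCocycle f z) k x) v‖ < 2}) :=
      isOpen_biInter_finset fun k _ => isOpen_lt
        (((continuous_cocycleIter_apply T hA k).comp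
          (continuous_id.prodMk continuous_const)).norm) continuous_const
    obtain ⟨_, ⟨m, rfl⟩, hx⟩ := (hT ω).exists_mem_open hopen ⟨ω', by
      rw [Set.mem_iInter₂]
      exact fun k _ => (hle k).trans_lt one_lt_two⟩
    rw [Set.mem_iInter₂] at hx
    -- The solution over `ω` that takes the value `v` at site `m`.
    let V : ℤ → C2 := fun n => matOp (cocycleIter T (szegoCocycle f z) (n - m) ((T ^ m) ω)) v
    have hV : ∀ n, V (n + 1) = matOp (szegoElt (f ((T ^ n) ω)) z) (V n) := fun n => by
      simp only [V]
      rw [show n + 1 - m = n - m + 1 by ring, cocycleIter_add_one, matOp_mul_apply,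
        ← Homeomorph.zpow_add_apply, sub_add_cancel]
      rfl
    obtain ⟨u, y, hVn, hy, hu⟩ := exists_generalized_eigenfunction
      (α := fun n : ℤ => f ((T ^ n) ω)) hV
    refine lower_bound_of_long_solution hC hy hu (m := m) hR ?_ fun n hn => ?_
    · rw [hVn]
      simp [V, matOp_one_apply, hv]
    · have h1 : ‖V n‖ < 2 := hx (n - m) (Finset.mem_Icc.2 (abs_le.1 hn))
      have h2 := hVn n
      refine abs_le_of_sq_le_sq' ?_ (by norm_num) |>.2
      nlinarith [norm_nonneg (V n), sq_nonneg ‖y n‖]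
  have hlim : Filter.Tendsto (fun R : ℕ => C ^ 2 * ((2 * R + 5) * (400 / (R : ℝ) ^ 2)))
      Filter.atTop (nhds 0) := by
    have h1 : Filter.Tendsto (fun R : ℕ => C ^ 2 * (800 * ((R : ℝ)⁻¹) + 2000 * ((R : ℝ)⁻¹ * (R : ℝ)⁻¹)))
        Filter.atTop (nhds (C ^ 2 * (800 * 0 + 2000 * (0 * 0)))) := by
      have h0 := tendsto_inv_atTop_nhds_zero_nat (𝕜 := ℝ)
      exact ((h0.const_mul _).add ((h0.mul h0).const_mul _)).const_mul _
    simp only [mul_zero, add_zero] at h1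
    refine h1.congr' ?_
    filter_upwards [Filter.eventually_gt_atTop 0] with R hR
    have : (R : ℝ) ≠ 0 := by exact_mod_cast hR.ne'
    field_simp
    ring
  obtain ⟨R, hR2, hR⟩ := ((Filter.eventually_ge_atTop 2).and
    (hlim.eventually (gt_mem_nhds (by norm_num : (0 : ℝ) < 1 / 64)))).exists
  exact absurd (hlow R hR2) (not_le.2 hR)

lemma spectrum_extendedCMV_eq [CompactSpace Ω] (hT : IsMinimalHomeo T) (hf : Continuous f) (ω : Ω) :
    spectrum ℂ (extendedCMV fun n : ℤ => f ((T ^ n) ω)) = Metric.sphere (0 : ℂ) 1 \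
      ((fun z : Circle => (z : ℂ)) '' {z | ¬ HasSackerSell T (szegoCocycle f z)}) := by
  ext w
  constructor
  · intro hw
    refine ⟨spectrum.subset_circle_of_unitary (extendedCMV_mem_unitary _) hw, ?_⟩
    rintro ⟨z, hz, rfl⟩
    exact notMem_spectrum_of_not_hasSackerSell hf hz ω hw
  · rintro ⟨hw, hnot⟩
    obtain ⟨z, rfl⟩ : ∃ z : Circle, (z : ℂ) = w := ⟨⟨w, hw⟩, rfl⟩
    by_contra hcon
    exact hnot ⟨z, fun h => hcon (mem_spectrum_of_hasSackerSell hT hf h ω), rfl⟩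

end Spectrum

theorem theorem2 {Ω : Type*} [MetricSpace Ω] [CompactSpace Ω] (T : Ω ≃ₜ Ω)
    (hT : IsMinimalHomeo T) (f : Ω → Complex.UnitDisc) (hf : Continuous f) :
    ∃ S : Set ℂ, IsCompact S ∧ S ⊆ Metric.sphere (0 : ℂ) 1 ∧
      (∀ ω : Ω, spectrum ℂ (extendedCMV fun n : ℤ => f ((T ^ n) ω)) = S) ∧
      S = Metric.sphere (0 : ℂ) 1 \
        ((fun z : Circle => (z : ℂ)) '' {z | UniformExpGrowth T (szegoCocycle f z)}) ∧
      S = Metric.sphere (0 : ℂ) 1 \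
        ((fun z : Circle => (z : ℂ)) '' {z | HasExpSplitting T (szegoCocycle f z)}) ∧
      S = Metric.sphere (0 : ℂ) 1 \
        ((fun z : Circle => (z : ℂ)) '' {z | ¬ HasSackerSell T (szegoCocycle f z)}) := by
  have hca : ∀ z : Circle, ¬ HasSackerSell T (szegoCocycle f z) →
      HasExpSplitting T (szegoCocycle f z) := fun z =>
    hasExpSplitting_of_not_hasSackerSell (continuous_szegoCocycle hf z)
  have hbc : ∀ z : Circle, UniformExpGrowth T (szegoCocycle f z) →
      ¬ HasSackerSell T (szegoCocycle f z) := fun z =>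
    not_hasSackerSell_of_uniformExpGrowth (continuous_szegoCocycle hf z)
  have hG : {z | UniformExpGrowth T (szegoCocycle f z)} =
      {z | ¬ HasSackerSell T (szegoCocycle f z)} :=
    Set.ext fun z => ⟨hbc z, fun h => uniformExpGrowth_of_hasExpSplitting (hca z h)⟩
  have hS : {z | HasExpSplitting T (szegoCocycle f z)} =
      {z | ¬ HasSackerSell T (szegoCocycle f z)} :=
    Set.ext fun z => ⟨fun h => hbc z (uniformExpGrowth_of_hasExpSplitting h), hca z⟩
  rw [hG, hS]
  refine ⟨_, ?_, Set.sdiff_subset, fun ω => spectrum_extendedCMV_eq hT hf ω, rfl, rfl, rfl⟩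
  rcases isEmpty_or_nonempty Ω with hΩ | ⟨⟨ω⟩⟩
  -- Over an empty base there are no orbits at all, so every point of the circle is removed.
  · convert isCompact_empty
    rw [Set.sdiff_eq_empty]
    intro w hw
    obtain ⟨z, rfl⟩ : ∃ z : Circle, (z : ℂ) = w := ⟨⟨w, hw⟩, rfl⟩
    exact ⟨z, fun ⟨ω, _⟩ => hΩ.elim ω, rfl⟩
  · rw [← spectrum_extendedCMV_eq hT hf ω]
    exact spectrum.isCompact _

end
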